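/- **Conventions.** For a permutation $\sigma$ of length $n=|\sigma|$ and a permutation $\pi$ of length $k$, a $k$-element set $K=\{i_1<\dots<i_k\}\subseteq\{1,\dots,n\}$ is an \emph{occurrence} of $\pi$ in $\sigma$ if $\sigma(i_1)\cdots\sigma(i_k)$ is order-isomorphic to $\pi$; its \emph{width} is $i_k-i_1+1$. Let $\rho(\pi,\sigma)$ be the proportion of all $k$-element subsets of $\{1,\dots,n\}$ that are occurrences of $\pi$, and, for real $w$, let $\rho_w(\pi,\sigma)$ be the proportion of the $k$-element subsets of width at most $w$ that are occurrences of $\pi$. Write $f\ll g$ if $f(n)/g(n)\to0$ as $n\to\infty$. A \emph{scaling function} is a function $f:\{1,2,\dots\}\to(0,\infty)$ with $1\ll f(n)\ll n$ and $f(n)\le n$ for all $n$. All sequences $(\sigma_j)$ of permutations below have $|\sigma_j|\to\infty$. * $(\sigma_j)$ \emph{converges at scale $f$} to $\Xi=(\Xi_\pi)_\pi$ if $\rho_{f(|\sigma_j|)}(\pi,\sigma_j)\to\Xi_\pi$ for every permutation $\pi$. A \emph{scale limit} is a vector $\Xi$ to which some sequence of permutations converges at some scaling function. * A \emph{permuton}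 is a Borel probability measure $\Gamma$ on $[0,1]^2$ with uniform marginals; $\rho(\pi,\Gamma)$ is the probability that $|\pi|$ independent points of law $\Gamma$, listed by increasing $x$-coordinate, have $y$-coordinates order-isomorphic to $\pi$. $(\sigma_j)$ \emph{converges globally} to $\Gamma$ if $\rho(\pi,\sigma_j)\to\rho(\pi,\Gamma)$ for every $\pi$. * A \emph{permutation local limit} is a shift-invariant random infinite rooted permutation, that is, a random total order $\Lambda$ on $\mathbb Z$ whose law is invariant under the shift of $\mathbb Z$. $(\sigma_j)$ \emph{converges locally} to $\Lambda$ if, for every $k$ and every $\pi$ of length $k$, $\rho_k(\pi,\sigma_j)$ tends to the probability that the restriction of $\Lambda$ to $k$ consecutive integers is order-isomorphic to $\pi$. **Theorem.** Let $\{f_t:t\in\mathbb N\}$ be a countably infinite set of scaling functions (indexed without repetition) that is totally ordered by domination: for all $s\ne t$, either $f_s\ll f_t$ or $f_t\ll f_s$. For each $t\in\mathbb N$ let $\Xi_t$ be any scale limit. Let $\Gamma$ be any permuton and $\Lambda$ any permutation local limit. Then there exists a sequence of permutations which converges to $\Xi_t$ at scale $f_t$ for each $t\in\mathbb N$, converges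 globally to $\Gamma$, and converges locally to $\Lambda$. -/

import Mathlib

open Filter Topology MeasureTheory

noncomputable section

/-- A permutation together with its length; `⟨n, σ⟩` is a permutation of `n` points
(indices and values run over `0, …, n - 1`). -/
abbrev FinPerm : Type := Σ n : ℕ, Equiv.Perm (Fin n)

namespace FinPerm

/-- The length of a permutation. -/
abbrev length (σ : FinPerm) : ℕ := σ.1

/-- The index set `K` is an occurrence of `π` in `σ`: it has `|π|` elements `i₁ < … < i_k`, and
the word `σ(i₁) … σ(i_k)` is order-isomorphic to `π`. -/
def IsOccurrence (π σ : FinPerm) (K : Finset (Fin σ.length)) : Prop :=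
  ∃ h : K.card = π.length, ∀ a b : Fin π.length,
    σ.2 (K.orderEmbOfFin h a) < σ.2 (K.orderEmbOfFin h b) ↔ π.2 a < π.2 b

/-- The index set `K` has width `max K - min K + 1` at most `w`. -/
def WidthLE {n : ℕ} (K : Finset (Fin n)) (w : ℝ) : Prop :=
  ∀ i ∈ K, ∀ j ∈ K, ((j : ℕ) : ℝ) - ((i : ℕ) : ℝ) + 1 ≤ w

open Classical in
/-- The `k`-element subsets of an `n`-element index set having width at most `w`. -/
def narrowSubsets (n k : ℕ) (w : ℝ) : Finset (Finset (Fin n)) :=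
  (Finset.univ.powersetCard k).filter fun K => WidthLE K w

open Classical in
/-- The global density `ρ(π, σ)`: the proportion of `|π|`-element index sets of `σ` that are
occurrences of `π`. -/
def globalDensity (π σ : FinPerm) : ℝ :=
  (((Finset.univ.powersetCard π.length).filter fun K => IsOccurrence π σ K).card : ℝ) /
    (σ.length.choose π.length : ℝ)

open Classical in
/-- The density `ρ_w(π, σ)` at scale `w`: the proportion of `|π|`-element index sets of `σ` of
width at most `w` that are occurrences of `π`. -/
def scaleDensity (w : ℝ) (π σ : FinPerm) : ℝ :=
  (((narrowSubsets σ.length π.length w).filter fun K => IsOccurrence π σ K).card : ℝ) /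
    ((narrowSubsets σ.length π.length w).card : ℝ)

/-- The local density of `π` in `σ`: the density of consecutive occurrences. -/
def localDensity (π σ : FinPerm) : ℝ := scaleDensity (π.length : ℝ) π σ

end FinPerm

/-- `f ≪ g`, that is `f(n) / g(n) → 0` as `n → ∞`. -/
def IsDominatedBy (f g : ℕ → ℝ) : Prop :=
  Tendsto (fun n => f n / g n) atTop (𝓝 0)

/-- Scaling functions: positive, `1 ≪ f(n) ≪ n`, and `f(n) ≤ n` for every positive integer `n`. -/
structure IsScalingFunction (f : ℕ → ℝ) : Prop where
  pos : ∀ n, 1 ≤ n → 0 < f n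
  le_self : ∀ n, 1 ≤ n → f n ≤ n
  one_dominated : IsDominatedBy (fun _ => 1) f
  dominated_self : IsDominatedBy f (fun n => n)

/-- The sequence `σ` of permutations (with lengths tending to infinity) converges at scale `f`
to the vector `Ξ` of pattern densities. -/
def ConvergesAtScale (f : ℕ → ℝ) (σ : ℕ → FinPerm) (Ξ : FinPerm → ℝ) : Prop :=
  Tendsto (fun j => (σ j).length) atTop atTop ∧
    ∀ π : FinPerm,
      Tendsto (fun j => FinPerm.scaleDensity (f (σ j).length) π (σ j)) atTop (𝓝 (Ξ π))

/-- `Ξ` is a scale limit: the limit of some sequence of permutations at some scale. -/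
def IsScaleLimit (Ξ : FinPerm → ℝ) : Prop :=
  ∃ g : ℕ → ℝ, IsScalingFunction g ∧ ∃ σ : ℕ → FinPerm, ConvergesAtScale g σ Ξ

/-- A permuton: a Borel probability measure on the unit square with uniform marginals. -/
structure Permuton where
  measure : Measure (unitInterval × unitInterval)
  isProbabilityMeasure : IsProbabilityMeasure measure
  fst_uniform : ∀ a b : unitInterval, a ≤ b →
    measure (Set.Icc a b ×ˢ Set.univ) = ENNReal.ofReal ((b : ℝ) - (a : ℝ))
  snd_uniform : ∀ a b : unitInterval, a ≤ b →
    measure (Set.univ ×ˢ Set.Icc a b) = ENNReal.ofReal ((b : ℝ) - (a : ℝ))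

/-- The points `p 0, …, p (k - 1)` of the unit square, listed by increasing `x`-coordinate, have
`y`-coordinates order-isomorphic to `π`. -/
def PointsInduce (π : FinPerm) (p : Fin π.length → unitInterval × unitInterval) : Prop :=
  ∃ s : Equiv.Perm (Fin π.length),
    StrictMono (fun a => (p (s a)).1) ∧
      ∀ a b : Fin π.length, (p (s a)).2 < (p (s b)).2 ↔ π.2 a < π.2 b

/-- The density `ρ(π, Γ)`: the probability that `|π|` independent points of law `Γ` induce
the permutation `π`. -/
def Permuton.density (π : FinPerm) (Γ : Permuton) : ℝ :=
  (Measure.pi fun _ : Fin π.length => Γ.measure).real {p | PointsInduce π p}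

/-- The sequence `σ` of permutations (with lengths tending to infinity) converges globally
to the permuton `Γ`. -/
def ConvergesGlobally (σ : ℕ → FinPerm) (Γ : Permuton) : Prop :=
  Tendsto (fun j => (σ j).length) atTop atTop ∧
    ∀ π : FinPerm, Tendsto (fun j => FinPerm.globalDensity π (σ j)) atTop (𝓝 (Γ.density π))

/-- Infinite rooted permutations: (non-strict) total orders on `ℤ`, the root being `0`. They carry
the σ-algebra generated by the events `i ≼ j`, i.e. by the restrictions to finite windows. -/
abbrev InfiniteRootedPerm : Type :=
  {r : ℤ → ℤ → Prop //
    (∀ i, r i i) ∧ (∀ i j k, r i j → r j k → r i k) ∧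
      (∀ i j, r i j → r j i → i = j) ∧ ∀ i j, r i j ∨ r j i}

/-- The shift `≼'` of a total order `≼` on `ℤ`: `i ≼' j` if and only if `i + 1 ≼ j + 1`. -/
def InfiniteRootedPerm.shift (r : InfiniteRootedPerm) : InfiniteRootedPerm :=
  ⟨fun i j => r.1 (i + 1) (j + 1),
    fun _ => r.2.1 _,
    fun _ _ _ => r.2.2.1 _ _ _,
    fun i j hij hji => by
      have h := r.2.2.2.1 _ _ hij hji
      omega,
    fun _ _ => r.2.2.2.2 _ _⟩

/-- Permutation local limits: (laws of) shift-invariant random infinite rooted permutations. -/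
structure PermutationLocalLimit where
  measure : Measure InfiniteRootedPerm
  isProbabilityMeasure : IsProbabilityMeasure measure
  shift_invariant : measure.map InfiniteRootedPerm.shift = measure

/-- The density of `π` in `Λ`: the probability that the random total order restricted to `|π|`
consecutive integers (which ones is irrelevant, by shift-invariance) is the pattern `π`. -/
def PermutationLocalLimit.density (π : FinPerm) (Λ : PermutationLocalLimit) : ℝ :=
  Λ.measure.real
    {r | ∀ a b : Fin π.length, r.1 ((a : ℕ) : ℤ) ((b : ℕ) : ℤ) ↔ π.2 a ≤ π.2 b}

/-- The sequence `σ` of permutations (with lengths tending to infinity) converges locally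
to `Λ`. -/
def ConvergesLocally (σ : ℕ → FinPerm) (Λ : PermutationLocalLimit) : Prop :=
  Tendsto (fun j => (σ j).length) atTop atTop ∧
    ∀ π : FinPerm, Tendsto (fun j => FinPerm.localDensity π (σ j)) atTop (𝓝 (Λ.density π))

end

/-! A diagonal argument reduces the theorem to finitely many patterns, finitely many scales and a
fixed error `ε`: the `j`-th permutation serves the first `j` patterns and scales with error `1 / (j
+ 1)`.

For finitely many scales the permutation is a nested inflation, built from the smallest scale
outwards. The innermost word repeats one permutation whose consecutive patterns approximate `Λ`. To
add a larger scale `w`, take a permutation of length `N` whose densities at some width `u`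
approximate the scale limit, with `u` large and `u / N` small. Repeat it periodically, and replace
each point by a copy of the first `w / u` entries of the word built so far. At scale `w` most tuples
meet each block at most once and therefore see the inflated permutation at width `u`. At scales far
below `w` most tuples stay inside one block and see the earlier word. The outermost level inflates
in the same way a fixed permutation of length `M` that approximates `Γ`.

`Attainable` is the induction hypothesis. Its words are chosen before the prefix length `ℓ`, because
the next level truncates them to blocks whose length depends on the next scale and on `u`.
`Attainable.union_scale` is the induction step and `Attainable.exists_word` adds the global level.
The error terms come from `abs_wordDensity_sub_average_le` (tuples within a block) and
`abs_wordDensity_sub_le_of_inflation` (tuples in distinct blocks), both cases of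
`abs_proportion_sub_le`.

The approximating permutations for `Λ` concatenate window patterns in proportion to their
probabilities (`PermutationLocalLimit.exists_perm`). Those for `Γ` come from random samples by a
second moment estimate (`Permuton.exists_word`). -/

noncomputable section

/-! ### Pattern densities of words on the natural numbers -/

open Classical in
/-- Strictly increasing `k`-tuples in `{0, …, n - 1}` of width at most `w`. -/
def narrowTuples (n k w : ℕ) : Finset (Fin k → ℕ) :=
  (Fintype.piFinset fun _ => Finset.range n).filter fun c =>
    StrictMono c ∧ ∀ a b, c b + 1 ≤ c a + w

lemma mem_narrowTuples {n k w : ℕ} {c : Fin k → ℕ} :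
    c ∈ narrowTuples n k w ↔
      (∀ a, c a < n) ∧ StrictMono c ∧ ∀ a b, c b + 1 ≤ c a + w := by
  simp [narrowTuples, Fintype.mem_piFinset]

/-- The word `v` restricted to the positions `c` is order-isomorphic to `π`. -/
def InducesPattern (v : ℕ → ℕ) (π : FinPerm) (c : Fin π.length → ℕ) : Prop :=
  ∀ a b, v (c a) < v (c b) ↔ π.2 a < π.2 b

open Classical in
/-- The proportion of narrow tuples in the prefix of length `n` of `v` at which `π` occurs. -/
def wordDensity (v : ℕ → ℕ) (n w : ℕ) (π : FinPerm) : ℝ :=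
  (((narrowTuples n π.length w).filter fun c => InducesPattern v π c).card : ℝ) /
    ((narrowTuples n π.length w).card : ℝ)

lemma wordDensity_nonneg (v : ℕ → ℕ) (n w : ℕ) (π : FinPerm) : 0 ≤ wordDensity v n w π := by
  unfold wordDensity; positivity

lemma wordDensity_le_one (v : ℕ → ℕ) (n w : ℕ) (π : FinPerm) : wordDensity v n w π ≤ 1 := by
  classical
  unfold wordDensity
  apply div_le_one_of_le₀ _ (by positivity)
  exact_mod_cast Finset.card_filter_le _ _

lemma wordDensity_of_length_eq_zero (v : ℕ → ℕ) (n w : ℕ) {π : FinPerm} (h : π.length = 0) :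
    wordDensity v n w π = 1 := by
  classical
  obtain ⟨k, p⟩ := π
  obtain rfl : k = 0 := h
  have h1 : ∀ c : Fin 0 → ℕ, InducesPattern v ⟨0, p⟩ c := fun c a => a.elim0
  have h2 : (narrowTuples n 0 w).Nonempty :=
    ⟨Fin.elim0, mem_narrowTuples.2 ⟨fun a => a.elim0, fun a => a.elim0, fun a => a.elim0⟩⟩
  have h3 : ((narrowTuples n 0 w).card : ℝ) ≠ 0 := by
    exact_mod_cast h2.card_pos.ne'
  simp [wordDensity, h1, div_self h3]

lemma wordDensity_congr {u v : ℕ → ℕ} {n : ℕ} (h : ∀ x < n, ∀ y < n, u x < u y ↔ v x < v y)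
    (w : ℕ) (π : FinPerm) : wordDensity u n w π = wordDensity v n w π := by
  classical
  unfold wordDensity
  congr 2
  refine congrArg _ (Finset.filter_congr fun c hc => ?_)
  have := (mem_narrowTuples.1 hc).1
  exact forall₂_congr fun a b => by rw [h _ (this a) _ (this b)]

/-- A set corresponds to its increasing enumeration. Widths are integers, so a real bound may be
replaced by its floor. -/
lemma card_filter_narrowSubsets {n k : ℕ} {w : ℝ} (hw : 0 ≤ w) (P : Finset (Fin n) → Prop)
    (Q : (Fin k → ℕ) → Prop) [DecidablePred P] [DecidablePred Q]
    (h : ∀ c : Fin k → Fin n, StrictMono c → (P (Finset.univ.image c) ↔ Q fun a => c a)) :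
    ((FinPerm.narrowSubsets n k w).filter P).card =
      ((narrowTuples n k ⌊w⌋₊).filter Q).card := by
  classical
  have hwidth : ∀ i j : ℕ, (j : ℝ) - i + 1 ≤ w ↔ j + 1 ≤ i + ⌊w⌋₊ := by
    intro i j
    rcases le_total i (j + 1) with hij | hij
    · have : (j : ℝ) - i + 1 = ((j + 1 - i : ℕ) : ℝ) := by push_cast [Nat.cast_sub hij]; ring
      rw [this, ← Nat.le_floor_iff hw]; omega
    · have : ((j + 1 : ℕ) : ℝ) ≤ i := by exact_mod_cast hij
      push_cast at this
      exact ⟨fun _ => by omega, fun _ => by linarith⟩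
  symm
  refine Finset.card_bij
    (fun c hc => Finset.univ.image fun a =>
      (⟨c a, (mem_narrowTuples.1 (Finset.mem_filter.1 hc).1).1 a⟩ : Fin n)) ?_ ?_ ?_
  · intro c hc
    obtain ⟨hc1, hc2⟩ := Finset.mem_filter.1 hc
    obtain ⟨h1, h2, h3⟩ := mem_narrowTuples.1 hc1
    have hmono : StrictMono fun a => (⟨c a, h1 a⟩ : Fin n) := fun a b hab => h2 hab
    rw [Finset.mem_filter, FinPerm.narrowSubsets, Finset.mem_filter, Finset.mem_powersetCard]
    refine ⟨⟨⟨Finset.subset_univ _, ?_⟩, ?_⟩, (h _ hmono).2 hc2⟩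
    · rw [Finset.card_image_of_injective _ hmono.injective]; simp
    · intro i hi j hj
      obtain ⟨a, -, rfl⟩ := Finset.mem_image.1 hi
      obtain ⟨b, -, rfl⟩ := Finset.mem_image.1 hj
      exact (hwidth _ _).2 (h3 a b)
  · intro c hc d hd hcd
    obtain ⟨h1, h2, -⟩ := mem_narrowTuples.1 (Finset.mem_filter.1 hc).1
    obtain ⟨h3, h4, -⟩ := mem_narrowTuples.1 (Finset.mem_filter.1 hd).1
    have hm1 : StrictMono fun a => (⟨c a, h1 a⟩ : Fin n) := fun a b hab => h2 hab
    have hm2 : StrictMono fun a => (⟨d a, h3 a⟩ : Fin n) := fun a b hab => h4 hab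
    have hr := congrArg (fun s : Finset (Fin n) => (s : Set (Fin n))) hcd
    simp only [Finset.coe_image, Finset.coe_univ, Set.image_univ] at hr
    have := (StrictMono.range_inj hm1 hm2).1 hr
    funext a
    simpa using congrArg Fin.val (congrFun this a)
  · intro K hK
    rw [Finset.mem_filter, FinPerm.narrowSubsets, Finset.mem_filter,
      Finset.mem_powersetCard] at hK
    obtain ⟨⟨⟨-, hcard⟩, hwd⟩, hP⟩ := hK
    have himg : Finset.univ.image (K.orderEmbOfFin hcard) = K := by
      apply Finset.coe_injective; simp
    have hmem : (fun a => ((K.orderEmbOfFin hcard a : Fin n) : ℕ)) ∈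
        (narrowTuples n k ⌊w⌋₊).filter Q := by
      refine Finset.mem_filter.2 ⟨mem_narrowTuples.2 ⟨fun a => Fin.is_lt _, ?_, ?_⟩, ?_⟩
      · exact fun a b hab => (K.orderEmbOfFin hcard).strictMono hab
      · exact fun a b => (hwidth _ _).1
          (hwd _ (Finset.orderEmbOfFin_mem _ _ _) _ (Finset.orderEmbOfFin_mem _ _ _))
      · rw [← h _ (K.orderEmbOfFin hcard).strictMono, himg]; exact hP
    exact ⟨_, hmem, himg⟩

lemma card_narrowSubsets_eq {n k : ℕ} {w : ℝ} (hw : 0 ≤ w) :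
    (FinPerm.narrowSubsets n k w).card = (narrowTuples n k ⌊w⌋₊).card := by
  simpa using card_filter_narrowSubsets (n := n) (k := k) hw (fun _ => True) (fun _ => True)
    (by simp)

lemma narrowSubsets_self (n k : ℕ) :
    FinPerm.narrowSubsets n k n = Finset.univ.powersetCard k := by
  classical
  refine Finset.filter_true_of_mem fun K _ i _ j _ => ?_
  have : ((j : ℕ) : ℝ) + 1 ≤ n := by exact_mod_cast j.2
  have : (0 : ℝ) ≤ ((i : ℕ) : ℝ) := by positivity
  linarith

lemma card_narrowTuples_self (n k : ℕ) : (narrowTuples n k n).card = n.choose k := by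
  have := card_narrowSubsets_eq (n := n) (k := k) (w := n) (by positivity)
  rw [narrowSubsets_self] at this
  simpa using this.symm

lemma scaleDensity_eq_wordDensity {σ : FinPerm} {v : ℕ → ℕ}
    (h : ∀ i j : Fin σ.length, σ.2 i < σ.2 j ↔ v i < v j) {w : ℝ} (hw : 0 ≤ w) (π : FinPerm) :
    FinPerm.scaleDensity w π σ = wordDensity v σ.length ⌊w⌋₊ π := by
  classical
  unfold FinPerm.scaleDensity wordDensity
  rw [card_narrowSubsets_eq hw,
    card_filter_narrowSubsets hw _ (fun c => InducesPattern v π c)]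
  intro c hc
  have hcard : (Finset.univ.image c).card = π.length := by
    rw [Finset.card_image_of_injective _ hc.injective]; simp
  have hemb : ∀ a, (Finset.univ.image c).orderEmbOfFin hcard a = c a := fun a =>
    (congrFun (Finset.orderEmbOfFin_unique hcard (fun x => by simp) hc) a).symm
  unfold FinPerm.IsOccurrence InducesPattern
  constructor
  · rintro ⟨h', H⟩ a b
    rw [← H a b, hemb, hemb, h]
  · intro H
    exact ⟨hcard, fun a b => by rw [← H a b, hemb, hemb, h]⟩

lemma globalDensity_eq_scaleDensity (π σ : FinPerm) :
    FinPerm.globalDensity π σ = FinPerm.scaleDensity σ.length π σ := by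
  unfold FinPerm.globalDensity FinPerm.scaleDensity
  rw [narrowSubsets_self]
  simp

lemma globalDensity_eq_wordDensity {σ : FinPerm} {v : ℕ → ℕ}
    (h : ∀ i j : Fin σ.length, σ.2 i < σ.2 j ↔ v i < v j) (π : FinPerm) :
    FinPerm.globalDensity π σ = wordDensity v σ.length σ.length π := by
  rw [globalDensity_eq_scaleDensity, scaleDensity_eq_wordDensity h (by positivity)]
  simp

/-! ### Comparing proportions and counting narrow tuples -/

/-- If a family `I` embeds into `T` compatibly with the predicates, then the proportions of
members that satisfy the predicates differ by at most the proportion of `T` that is missed. -/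
lemma abs_proportion_sub_le {ι κ : Type*} (I : Finset ι) (T : Finset κ) (φ : ι → κ)
    (hinj : Set.InjOn φ I) (hmaps : ∀ i ∈ I, φ i ∈ T) (P : ι → Prop) (Q : κ → Prop)
    [DecidablePred P] [DecidablePred Q] (h : ∀ i ∈ I, Q (φ i) ↔ P i) :
    |((T.filter Q).card : ℝ) / T.card - ((I.filter P).card : ℝ) / I.card| ≤
      1 - (I.card : ℝ) / T.card := by
  classical
  -- Both the members satisfying the predicate and those violating it inject; the first count bounds
  -- the difference from below, the second from above.
  have h1 : (I.filter P).card ≤ (T.filter Q).card := by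
    refine Finset.card_le_card_of_injOn φ ?_ (hinj.mono (Finset.coe_subset.2 (Finset.filter_subset _ _)))
    intro i hi
    rw [Finset.mem_coe, Finset.mem_filter] at hi ⊢
    exact ⟨hmaps i hi.1, (h i hi.1).2 hi.2⟩
  have h2 : (I.filter fun i => ¬ P i).card ≤ (T.filter fun i => ¬ Q i).card := by
    refine Finset.card_le_card_of_injOn φ ?_ (hinj.mono (Finset.coe_subset.2 (Finset.filter_subset _ _)))
    intro i hi
    rw [Finset.mem_coe, Finset.mem_filter] at hi ⊢
    exact ⟨hmaps i hi.1, fun hq => hi.2 ((h i hi.1).1 hq)⟩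
  have h3 := Finset.card_filter_add_card_filter_not (s := I) P
  have h4 := Finset.card_filter_add_card_filter_not (s := T) Q
  generalize (I.filter P).card = a at *
  generalize (T.filter Q).card = x at *
  generalize (I.filter fun i => ¬ P i).card = a' at *
  generalize (T.filter fun i => ¬ Q i).card = x' at *
  rw [← h3, ← h4]
  push_cast
  have h1' : (a : ℝ) ≤ x := by exact_mod_cast h1
  have h2' : (a' : ℝ) ≤ x' := by exact_mod_cast h2
  have ha : (0 : ℝ) ≤ a := by positivity
  have ha' : (0 : ℝ) ≤ a' := by positivity
  generalize (a : ℝ) = a at *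
  generalize (a' : ℝ) = a' at *
  generalize (x : ℝ) = x at *
  generalize (x' : ℝ) = x' at *
  -- If `I` is empty its proportion is `0 / 0 = 0` and the bound is `1`.
  rcases (add_nonneg ha ha').eq_or_lt with h0 | h0
  · rw [← h0]
    have : 0 ≤ x / (x + x') := by apply div_nonneg <;> linarith
    simp only [div_zero, sub_zero, zero_div]
    rw [abs_of_nonneg this]
    exact div_le_one_of_le₀ (by linarith) (by linarith)
  · have hT : 0 < x + x' := by linarith
    have e1 : a / (a + a') * ((a + a') / (x + x')) = a / (x + x') := by field_simp
    have e2 : a / (a + a') ≤ 1 := div_le_one_of_le₀ (by linarith) h0.le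
    have e2' : 0 ≤ a / (a + a') := by positivity
    have e3 : (a + a') / (x + x') ≤ 1 := div_le_one_of_le₀ (by linarith) hT.le
    have e4 : a / (x + x') ≤ x / (x + x') := by gcongr
    have e5 : x / (x + x') ≤ 1 - a' / (x + x') := by
      rw [le_sub_iff_add_le, ← add_div]; exact div_le_one_of_le₀ (by linarith) hT.le
    have e6 : (a + a') / (x + x') = a / (x + x') + a' / (x + x') := add_div _ _ _
    rw [abs_le]
    constructor <;> nlinarith

/-- The smallest position has at most `n` values, and the other `k` positions lie among the next `w
- 1`. -/
lemma card_narrowTuples_succ_le (n k w : ℕ) (hw : 1 ≤ w) :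
    (narrowTuples n (k + 1) w).card ≤ n * (w - 1).choose k := by
  classical
  rw [← card_narrowTuples_self (w - 1) k]
  conv_rhs => rw [← Finset.card_range n]
  rw [← Finset.card_product]
  refine Finset.card_le_card_of_injOn
    (fun c => (c 0, fun a : Fin k => c a.succ - c 0 - 1)) ?_ ?_
  · intro c hc
    obtain ⟨h1, h2, h3⟩ := mem_narrowTuples.1 (Finset.mem_coe.1 hc)
    have h4 : ∀ a : Fin k, c 0 < c a.succ := fun a => h2 (Fin.succ_pos a)
    refine Finset.mem_coe.2 (Finset.mem_product.2 ⟨Finset.mem_range.2 (h1 0),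
      mem_narrowTuples.2 ⟨fun a => ?_, fun a b hab => ?_, fun a b => ?_⟩⟩)
    · have := h4 a; have := h3 0 a.succ; dsimp only; omega
    · have := h4 a; have := h2 (Fin.succ_lt_succ_iff.2 hab); dsimp only; omega
    · have := h4 a; have := h4 b; have := h3 0 b.succ; dsimp only; omega
  · intro c hc d hd hcd
    have h2 := (mem_narrowTuples.1 (Finset.mem_coe.1 hc)).2.1
    have h2' := (mem_narrowTuples.1 (Finset.mem_coe.1 hd)).2.1
    obtain ⟨e1, e2⟩ := Prod.mk.inj hcd
    funext a
    refine Fin.cases e1 (fun b => ?_) a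
    have h4 := h2 (Fin.succ_pos b)
    have h5 := h2' (Fin.succ_pos b)
    have := congrFun e2 b
    omega

/-- If the smallest position is below `n - w`, every choice of the others among the next `w - 1`
positions fits. -/
lemma le_card_narrowTuples_succ (n k w : ℕ) (hw : 1 ≤ w) :
    (n - w) * (w - 1).choose k ≤ (narrowTuples n (k + 1) w).card := by
  classical
  rw [← card_narrowTuples_self (w - 1) k]
  conv_lhs => rw [← Finset.card_range (n - w)]
  rw [← Finset.card_product]
  refine Finset.card_le_card_of_injOn
    (fun p => Fin.cons p.1 (fun a : Fin k => p.1 + 1 + p.2 a)) ?_ ?_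
  · rintro ⟨i, d⟩ hp
    obtain ⟨hi, hd⟩ := Finset.mem_product.1 (Finset.mem_coe.1 hp)
    obtain ⟨h1, h2, h3⟩ := mem_narrowTuples.1 hd
    have hi := Finset.mem_range.1 hi
    dsimp only at h1 h2 h3 hi
    refine Finset.mem_coe.2 (mem_narrowTuples.2 ⟨fun a => ?_, fun a b => ?_, fun a b => ?_⟩)
    · refine Fin.cases ?_ (fun a => ?_) a
      · simp; omega
      · have := h1 a; simp; omega
    · refine Fin.cases (fun b => ?_) (fun a b => ?_) a b
      · refine Fin.cases (fun h => absurd h (lt_irrefl _)) (fun b _ => ?_) b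
        simp; omega
      · refine Fin.cases (fun h => absurd h (Fin.not_lt_zero _)) (fun b hab => ?_) b
        have := h2 (Fin.succ_lt_succ_iff.1 hab)
        simpa using this
    · refine Fin.cases ?_ (fun a => ?_) a <;> refine Fin.cases ?_ (fun b => ?_) b
      · simp; omega
      · have := h1 b; simp; omega
      · simp; omega
      · have := h1 b; simp; omega
  · rintro ⟨i, d⟩ - ⟨i', d'⟩ - h
    obtain ⟨rfl, h⟩ := Fin.cons_inj.1 h
    refine Prod.ext rfl (funext fun a => ?_)
    have := congrFun h a
    dsimp only at this ⊢
    omega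

/-! ### Densities of block words and inflations -/

/-- The `q` disjoint blocks of length `b` at the beginning of `v` determine the densities of `v`
at a scale `w` much smaller than `b`. -/
lemma abs_wordDensity_sub_average_le {v : ℕ → ℕ} {u : ℕ → ℕ → ℕ} {n b q w : ℕ} (hb : 0 < b)
    (hqb : q * b ≤ n)
    (huv : ∀ i < q, ∀ x < b, ∀ y < b, v (i * b + x) < v (i * b + y) ↔ u i x < u i y)
    (π : FinPerm) (hπ : 0 < π.length) (hw : π.length ≤ w) :
    |wordDensity v n w π - (∑ i ∈ Finset.range q, wordDensity (u i) b w π) / q| ≤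
      1 - q * ((b : ℝ) - w) / n := by
  classical
  -- The tuples that stay within one block, recorded as a block index and a tuple inside the block.
  set I := Finset.range q ×ˢ narrowTuples b π.length w with hI
  have hIcard : I.card = q * (narrowTuples b π.length w).card := by
    rw [hI, Finset.card_product, Finset.card_range]
  have hlt : ∀ i < q, ∀ x < b, i * b + x < n := by
    intro i hi x hx
    calc i * b + x < (i + 1) * b := by rw [add_mul]; omega
      _ ≤ q * b := Nat.mul_le_mul_right _ hi
      _ ≤ n := hqb
  have hmaps : ∀ p ∈ I, (fun a => p.1 * b + p.2 a) ∈ narrowTuples n π.length w := by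
    rintro ⟨i, c⟩ hp
    obtain ⟨hi, hc⟩ := Finset.mem_product.1 hp
    obtain ⟨h1, h2, h3⟩ := mem_narrowTuples.1 hc
    refine mem_narrowTuples.2 ⟨fun a => hlt _ (Finset.mem_range.1 hi) _ (h1 a),
      fun a a' h => Nat.add_lt_add_left (h2 h) _, fun a a' => ?_⟩
    have := h3 a a'
    dsimp only at this ⊢
    omega
  -- The block index is read off from the first entry; this fails for the empty tuple, hence `0 <
  -- π.length`.
  have hinj : Set.InjOn (fun (p : ℕ × (Fin π.length → ℕ)) a => p.1 * b + p.2 a) I := by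
    rintro ⟨i, c⟩ hp ⟨i', c'⟩ hp' h
    have h1 := (mem_narrowTuples.1 (Finset.mem_product.1 (Finset.mem_coe.1 hp)).2).1
    have h1' := (mem_narrowTuples.1 (Finset.mem_product.1 (Finset.mem_coe.1 hp')).2).1
    dsimp only at h1 h1' h
    have key : ∀ j x, x < b → (j * b + x) / b = j := fun j x hx => by
      rw [mul_comm, Nat.mul_add_div hb, Nat.div_eq_of_lt hx, add_zero]
    have e : i = i' := by
      rw [← key i _ (h1 ⟨0, hπ⟩), ← key i' _ (h1' ⟨0, hπ⟩)]
      exact congrArg (· / b) (congrFun h ⟨0, hπ⟩)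
    subst e
    exact Prod.ext rfl (funext fun a => Nat.add_left_cancel (congrFun h a))
  have main := abs_proportion_sub_le I (narrowTuples n π.length w) _ hinj hmaps
    (fun p => InducesPattern (u p.1) π p.2) (fun c => InducesPattern v π c) (by
      rintro ⟨i, c⟩ hp
      obtain ⟨hi, hc⟩ := Finset.mem_product.1 hp
      have h1 := (mem_narrowTuples.1 hc).1
      exact forall₂_congr fun a a' => by
        rw [huv i (Finset.mem_range.1 hi) _ (h1 a) _ (h1 a')])
  have hsum : ((I.filter fun p => InducesPattern (u p.1) π p.2).card : ℝ) / I.card =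
      (∑ i ∈ Finset.range q, wordDensity (u i) b w π) / q := by
    have : (I.filter fun p => InducesPattern (u p.1) π p.2).card =
        ∑ i ∈ Finset.range q,
          ((narrowTuples b π.length w).filter fun c => InducesPattern (u i) π c).card := by
      rw [Finset.card_filter, hI, Finset.sum_product]
      exact Finset.sum_congr rfl fun i _ => (Finset.card_filter _ _).symm
    rw [this, hIcard]
    unfold wordDensity
    rw [← Finset.sum_div]
    push_cast
    rw [div_div, mul_comm]
  rw [hsum] at main
  refine main.trans (sub_le_sub_left ?_ 1)
  obtain ⟨k, hk⟩ : ∃ k, π.length = k + 1 := ⟨π.length - 1, by omega⟩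
  have hw1 : 1 ≤ w := by omega
  have hle : I.card ≤ (narrowTuples n π.length w).card :=
    Finset.card_le_card_of_injOn _ hmaps hinj
  have up := card_narrowTuples_succ_le n k w hw1
  have lo := le_card_narrowTuples_succ b k w hw1
  rw [← hk] at up lo
  have hr : 0 < (w - 1).choose k := Nat.choose_pos (by omega)
  -- The common factor `(w - 1).choose k` cancels from the two counts, leaving `q * (b - w) / n`.
  -- For `b ≤ w` this quantity is not positive and there is nothing to prove.
  rcases le_or_gt b w with hbw | hbw
  · have : ((b : ℝ) - w) ≤ 0 := by
      have : (b : ℝ) ≤ w := by exact_mod_cast hbw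
      linarith
    refine (div_nonpos_of_nonpos_of_nonneg
      (mul_nonpos_of_nonneg_of_nonpos (by positivity) this) (by positivity)).trans (by positivity)
  rw [← Nat.cast_sub hbw.le]
  have lo' : q * (b - w) * (w - 1).choose k ≤ I.card := by
    rw [hIcard, mul_assoc]; exact Nat.mul_le_mul_left _ lo
  rcases Nat.eq_zero_or_pos n with rfl | hn
  · simp only [Nat.cast_zero, div_zero]; positivity
  rcases Nat.eq_zero_or_pos (narrowTuples n π.length w).card with h0 | h0
  · have : q * (b - w) = 0 := by
      by_contra h
      have : 0 < q * (b - w) * (w - 1).choose k := Nat.mul_pos (Nat.pos_of_ne_zero h) hr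
      omega
    rw [← Nat.cast_mul, this]
    simp only [Nat.cast_zero, zero_div]; positivity
  rw [div_le_div_iff₀ (by exact_mod_cast hn) (by exact_mod_cast h0)]
  norm_cast
  refine Nat.le_of_mul_le_mul_right ?_ hr
  calc q * (b - w) * (narrowTuples n π.length w).card * (w - 1).choose k
      = (q * (b - w) * (w - 1).choose k) * (narrowTuples n π.length w).card := by ring
    _ ≤ I.card * (n * (w - 1).choose k) := Nat.mul_le_mul lo' up
    _ = I.card * n * (w - 1).choose k := by ring

lemma abs_wordDensity_sub_le_of_blocks {v u : ℕ → ℕ} {n b q w : ℕ} (hb : 0 < b) (hq : 0 < q)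
    (hqb : q * b ≤ n)
    (huv : ∀ i < q, ∀ x < b, ∀ y < b, v (i * b + x) < v (i * b + y) ↔ u x < u y)
    (π : FinPerm) (hw : π.length ≤ w) :
    |wordDensity v n w π - wordDensity u b w π| ≤ 1 - q * ((b : ℝ) - w) / n := by
  rcases Nat.eq_zero_or_pos π.length with h | h
  · rw [wordDensity_of_length_eq_zero _ _ _ h, wordDensity_of_length_eq_zero _ _ _ h]
    rw [sub_self, abs_zero, sub_nonneg]
    have h1 : (q : ℝ) * b ≤ n := by exact_mod_cast hqb
    have h2 : (0 : ℝ) ≤ q * w := by positivity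
    exact div_le_one_of_le₀ (by nlinarith) (by positivity)
  · have := abs_wordDensity_sub_average_le hb hqb (u := fun _ => u) huv π h hw
    have hq' : (q : ℝ) ≠ 0 := by positivity
    simpa [hq'] using this

/-- If `v` is an inflation of the prefix of length `N` of `s` by blocks of length `b`, then its
densities at scale `w` are close to those of `s` at scale `u`, provided that `b * u` is close to
`w` in the sense that most narrow tuples come from `s`. -/
lemma abs_wordDensity_sub_le_of_inflation {v s : ℕ → ℕ} {N b u w : ℕ} (hb : 0 < b)
    (hbu : b * u ≤ w)
    (hvs : ∀ x < N * b, ∀ y < N * b, x / b ≠ y / b → (v x < v y ↔ s (x / b) < s (y / b)))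
    (π : FinPerm) :
    |wordDensity v (N * b) w π - wordDensity s N u π| ≤
      1 - (b : ℝ) ^ π.length * (narrowTuples N π.length u).card /
        (narrowTuples (N * b) π.length w).card := by
  classical
  set O : Finset (Fin π.length → ℕ) := Fintype.piFinset fun _ => Finset.range b with hO
  -- A narrow tuple of `s` selects distinct blocks, and `O` selects an offset in each of them.
  -- Whether the resulting tuple is an occurrence depends on the blocks only.
  set I := narrowTuples N π.length u ×ˢ O with hI
  have hOcard : O.card = b ^ π.length := by simp [hO]
  have hOpos : (O.card : ℝ) ≠ 0 := by rw [hOcard]; positivity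
  have hmemO : ∀ {o}, o ∈ O ↔ ∀ a, o a < b := by simp [hO, Fintype.mem_piFinset]
  have hdiv : ∀ j x, x < b → (b * j + x) / b = j := fun j x hx => by
    rw [Nat.mul_add_div hb, Nat.div_eq_of_lt hx, add_zero]
  have hlt : ∀ i < N, ∀ x < b, b * i + x < N * b := by
    intro i hi x hx
    calc b * i + x < b * (i + 1) := by rw [mul_add]; omega
      _ ≤ b * N := Nat.mul_le_mul_left _ hi
      _ = N * b := mul_comm _ _
  have hmaps : ∀ p ∈ I, (fun a => b * p.1 a + p.2 a) ∈ narrowTuples (N * b) π.length w := by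
    rintro ⟨d, o⟩ hp
    obtain ⟨hd, ho⟩ := Finset.mem_product.1 hp
    obtain ⟨h1, h2, h3⟩ := mem_narrowTuples.1 hd
    have ho := hmemO.1 ho
    dsimp only at h1 h2 h3 ho
    refine mem_narrowTuples.2 ⟨fun a => hlt _ (h1 a) _ (ho a), fun a a' h => ?_, fun a a' => ?_⟩
    · have h4 : b * (d a + 1) ≤ b * d a' := Nat.mul_le_mul_left _ (h2 h)
      have := ho a
      rw [mul_add] at h4
      dsimp only
      omega
    · have h4 : b * (d a' + 1) ≤ b * (d a + u) := Nat.mul_le_mul_left _ (h3 a a')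
      have := ho a'
      rw [mul_add, mul_add] at h4
      dsimp only
      omega
  have hinj : Set.InjOn
      (fun (p : (Fin π.length → ℕ) × (Fin π.length → ℕ)) a => b * p.1 a + p.2 a) I := by
    rintro ⟨d, o⟩ hp ⟨d', o'⟩ hp' h
    have h1 := hmemO.1 (Finset.mem_product.1 (Finset.mem_coe.1 hp)).2
    have h1' := hmemO.1 (Finset.mem_product.1 (Finset.mem_coe.1 hp')).2
    dsimp only at h1 h1' h
    have e : d = d' := funext fun a => by
      rw [← hdiv (d a) _ (h1 a), ← hdiv (d' a) _ (h1' a)]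
      exact congrArg (· / b) (congrFun h a)
    subst e
    exact Prod.ext rfl (funext fun a => Nat.add_left_cancel (congrFun h a))
  have main := abs_proportion_sub_le I (narrowTuples (N * b) π.length w) _ hinj hmaps
    (fun p => InducesPattern s π p.1) (fun c => InducesPattern v π c) (by
      rintro ⟨d, o⟩ hp
      obtain ⟨hd, ho⟩ := Finset.mem_product.1 hp
      obtain ⟨h1, h2, -⟩ := mem_narrowTuples.1 hd
      have ho := hmemO.1 ho
      dsimp only at h1 h2 ho
      refine forall₂_congr fun a a' => ?_
      rcases eq_or_ne a a' with rfl | hne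
      · simp
      · dsimp only
        rw [hvs _ (hlt _ (h1 a) _ (ho a)) _ (hlt _ (h1 a') _ (ho a')), hdiv _ _ (ho a),
          hdiv _ _ (ho a')]
        rw [hdiv _ _ (ho a), hdiv _ _ (ho a')]
        exact fun h => hne (h2.injective h))
  have hsum : ((I.filter fun p => InducesPattern s π p.1).card : ℝ) / I.card =
      wordDensity s N u π := by
    have : I.filter (fun p => InducesPattern s π p.1) =
        ((narrowTuples N π.length u).filter fun c => InducesPattern s π c) ×ˢ O := by
      ext ⟨d, o⟩
      simp only [hI, Finset.mem_filter, Finset.mem_product]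
      tauto
    rw [this, hI, Finset.card_product, Finset.card_product]
    unfold wordDensity
    push_cast
    rw [mul_div_mul_right _ _ hOpos]
  rw [hsum] at main
  refine main.trans_eq ?_
  rw [hI, Finset.card_product, hOcard]
  push_cast
  rw [mul_comm]

/-- With `q = n / b` blocks, `b / n` accounts for the incomplete last block and `w / b` for tuples
that straddle a block boundary. -/
lemma abs_wordDensity_sub_le_add {v u : ℕ → ℕ} {n b w : ℕ} (hb : 0 < b) (hbn : b ≤ n)
    (huv : ∀ i, ∀ x < b, ∀ y < b, v (i * b + x) < v (i * b + y) ↔ u x < u y)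
    (π : FinPerm) (hw : π.length ≤ w) :
    |wordDensity v n w π - wordDensity u b w π| ≤ (b : ℝ) / n + w / b := by
  refine (abs_wordDensity_sub_le_of_blocks hb (Nat.div_pos hbn hb) (Nat.div_mul_le_self n b)
    (fun i _ => huv i) π hw).trans ?_
  have hn : (0 : ℝ) < n := by exact_mod_cast hb.trans_le hbn
  have hb' : (0 : ℝ) < b := by exact_mod_cast hb
  have h1 : ((n / b : ℕ) : ℝ) * b ≤ n := by exact_mod_cast Nat.div_mul_le_self n b
  have h2 : (n : ℝ) ≤ ((n / b : ℕ) : ℝ) * b + b := by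
    have := Nat.div_add_mod n b
    have := Nat.mod_lt n hb
    have : n ≤ n / b * b + b := by rw [mul_comm]; omega
    exact_mod_cast this
  generalize ((n / b : ℕ) : ℝ) = q at *
  have h3 : q * w / n ≤ w / b := by
    rw [div_le_div_iff₀ hn hb']
    have : (0 : ℝ) ≤ w := by positivity
    nlinarith
  have h4 : 1 - b / n ≤ q * b / n := by
    rw [← div_self hn.ne', ← sub_div]; gcongr; linarith
  have : q * ((b : ℝ) - w) / n = q * b / n - q * w / n := by ring
  linarith

lemma pow_sub_le_choose_mul_factorial (u k : ℕ) (hku : k ≤ u) (hu : 0 < u) :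
    ((u : ℝ) - k) ^ k ≤ (u - 1).choose k * k.factorial := by
  have h := Nat.pow_sub_le_descFactorial (u - 1) k
  rw [Nat.descFactorial_eq_factorial_mul_choose] at h
  have e : u - 1 + 1 - k = u - k := by omega
  rw [e] at h
  rw [← Nat.cast_sub hku, mul_comm]
  exact_mod_cast h

lemma choose_mul_factorial_le_pow (w k : ℕ) :
    ((w - 1).choose k : ℝ) * k.factorial ≤ (w : ℝ) ^ k := by
  have h := Nat.descFactorial_le_pow (w - 1) k
  rw [Nat.descFactorial_eq_factorial_mul_choose] at h
  have h2 : (w - 1) ^ k ≤ w ^ k := Nat.pow_le_pow_left (by omega) k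
  rw [mul_comm]
  exact_mod_cast h.trans h2

/-- The proportion of narrow tuples of an inflation that come from the inflated permutation. -/
lemma one_sub_le_card_ratio {N b u w k : ℕ} {δ : ℝ} (hδ : δ ≤ 1) (hb : 0 < b) (hN : 0 < N)
    (hu : 0 < u) (hbw : b = w / u) (h1 : (u : ℝ) / N ≤ δ) (h2 : (k : ℝ) / u ≤ δ)
    (h3 : (u : ℝ) / w ≤ δ) :
    1 - 2 * k * δ ≤ (b : ℝ) ^ k * (narrowTuples N k u).card / (narrowTuples (N * b) k w).card := by
  have hδ0 : 0 ≤ δ := le_trans (by positivity) h1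
  rcases k with _ | k
  · have : ∀ n w, (narrowTuples n 0 w).card = 1 := by
      intro n w
      rw [Finset.card_eq_one]
      refine ⟨Fin.elim0, Finset.eq_singleton_iff_unique_mem.2
        ⟨mem_narrowTuples.2 ⟨fun a => a.elim0, fun a => a.elim0, fun a => a.elim0⟩,
          fun c _ => Subsingleton.elim _ _⟩⟩
    simp [this]
  have hw : 0 < w := by
    rcases Nat.eq_zero_or_pos w with rfl | h
    · simp at hbw; omega
    · exact h
  have hNr : (0 : ℝ) < N := by exact_mod_cast hN
  have hur : (0 : ℝ) < u := by exact_mod_cast hu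
  have hwr : (0 : ℝ) < w := by exact_mod_cast hw
  have hbr : (0 : ℝ) < b := by exact_mod_cast hb
  rw [div_le_iff₀ hNr] at h1
  rw [div_le_iff₀ hur] at h2
  rw [div_le_iff₀ hwr] at h3
  have huN : u ≤ N := by
    have : (u : ℝ) ≤ N := by nlinarith
    exact_mod_cast this
  have hku : k + 1 ≤ u := by
    have : ((k + 1 : ℕ) : ℝ) ≤ u := by nlinarith
    exact_mod_cast this
  have hbu : (w : ℝ) - u ≤ b * u := by
    have h4 := Nat.div_add_mod w u
    have h5 := Nat.mod_lt w hu
    rw [← hbw] at h4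
    have : w ≤ b * u + u := by rw [mul_comm]; omega
    have : (w : ℝ) ≤ b * u + u := by exact_mod_cast this
    linarith
  have huw : u ≤ w := by
    have : (u : ℝ) ≤ w := by nlinarith
    exact_mod_cast this
  have up := card_narrowTuples_succ_le (N * b) k w hw
  have lo := le_card_narrowTuples_succ N k u hu
  have up' : ((narrowTuples (N * b) (k + 1) w).card : ℝ) ≤ N * b * (w - 1).choose k := by
    exact_mod_cast up
  have lo' : ((N : ℝ) - u) * (u - 1).choose k ≤ (narrowTuples N (k + 1) u).card := by
    rw [← Nat.cast_sub huN]; exact_mod_cast lo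
  have hA := pow_sub_le_choose_mul_factorial u k (by omega) hu
  have hB := choose_mul_factorial_le_pow w k
  have hTpos : (0 : ℝ) < (narrowTuples (N * b) (k + 1) w).card := by
    have : narrowTuples (N * b) (k + 1) w ≠ ∅ := by
      rw [← Finset.nonempty_iff_ne_empty]
      refine ⟨fun a => a, mem_narrowTuples.2 ⟨fun a => ?_, fun a b h => h, fun a b => ?_⟩⟩
      · have := a.2
        have : N ≤ N * b := Nat.le_mul_of_pos_right _ hb
        omega
      · have := b.2; omega
    exact_mod_cast Finset.card_pos.2 (Finset.nonempty_iff_ne_empty.2 this)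
  have hf : (0 : ℝ) < k.factorial := by exact_mod_cast k.factorial_pos
  have hd1 : (0 : ℝ) ≤ 1 - δ := by linarith
  have hk0 : (0 : ℝ) ≤ k := by positivity
  -- The smallest position costs one factor `1 - δ`, from `u / N ≤ δ`. Each of the other `k` costs
  -- two: one for rounding in `b = w / u`, one for `k` against `u`.
  have hbernoulli : 1 - 2 * ((k + 1 : ℕ) : ℝ) * δ ≤ (1 - δ) * ((1 - δ) ^ 2) ^ k := by
    have := one_add_mul_le_pow (a := -δ) (by linarith) (2 * k + 1)
    have e : (1 + -δ) ^ (2 * k + 1) = (1 - δ) * ((1 - δ) ^ 2) ^ k := by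
      rw [pow_succ, pow_mul]; ring
    rw [e] at this
    push_cast at this ⊢
    linarith
  have hcore : (1 - δ) ^ 2 * w ≤ b * (u - k) := by
    have e1 : (1 - δ) * w ≤ w - u := by linarith
    have e2 : (1 - δ) * u ≤ u - k := by push_cast at h2; linarith
    have e3 : (1 - δ) * ((1 - δ) * w) * u ≤ (b * (u - k)) * u := by
      calc (1 - δ) * ((1 - δ) * w) * u ≤ (1 - δ) * (b * u) * u := by
            have : (1 - δ) * (w : ℝ) ≤ b * u := e1.trans hbu
            gcongr
        _ = (b * ((1 - δ) * u)) * u := by ring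
        _ ≤ (b * (u - k)) * u := by gcongr
    have := le_of_mul_le_mul_right e3 hur
    linarith [this]
  refine hbernoulli.trans ?_
  rw [le_div_iff₀ hTpos]
  refine le_of_mul_le_mul_right ?_ hf
  calc (1 - δ) * ((1 - δ) ^ 2) ^ k * (narrowTuples (N * b) (k + 1) w).card * k.factorial
      ≤ (1 - δ) * ((1 - δ) ^ 2) ^ k * (N * b * (w - 1).choose k) * k.factorial := by gcongr
    _ = (1 - δ) * ((1 - δ) ^ 2) ^ k * (N * b) * ((w - 1).choose k * k.factorial) := by ring
    _ ≤ (1 - δ) * ((1 - δ) ^ 2) ^ k * (N * b) * (w : ℝ) ^ k := by gcongr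
    _ = ((1 - δ) * N) * b * ((1 - δ) ^ 2 * w) ^ k := by rw [mul_pow]; ring
    _ ≤ (N - u) * b * (b * (u - k)) ^ k := by
        have e1 : (0 : ℝ) ≤ (N - u) := by rw [sub_nonneg]; exact_mod_cast huN
        have e2 : (1 - δ) * (N : ℝ) ≤ N - u := by linarith
        gcongr
    _ = (N - u) * b ^ (k + 1) * (u - k) ^ k := by rw [mul_pow]; ring
    _ ≤ (N - u) * b ^ (k + 1) * ((u - 1).choose k * k.factorial) := by
        have : (0 : ℝ) ≤ N - u := by rw [sub_nonneg]; exact_mod_cast huN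
        gcongr
    _ = (b : ℝ) ^ (k + 1) * (((N : ℝ) - u) * (u - 1).choose k) * k.factorial := by ring
    _ ≤ (b : ℝ) ^ (k + 1) * (narrowTuples N (k + 1) u).card * k.factorial := by gcongr

/-- The case without width restriction, needed for global densities. It is not an instance of
`one_sub_le_card_ratio`, where `u / N` has to be small. -/
lemma one_sub_le_card_ratio_self {N b k : ℕ} {δ : ℝ} (hδ : δ ≤ 1) (hb : 0 < b) (hN : 0 < N)
    (h : (k : ℝ) / N ≤ δ) :
    1 - k * δ ≤ (b : ℝ) ^ k * (narrowTuples N k N).card /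
      (narrowTuples (N * b) k (N * b)).card := by
  rw [card_narrowTuples_self, card_narrowTuples_self]
  have hNr : (0 : ℝ) < N := by exact_mod_cast hN
  have hbr : (0 : ℝ) < b := by exact_mod_cast hb
  rw [div_le_iff₀ hNr] at h
  have hkN : k ≤ N := by
    have : (k : ℝ) ≤ N := by nlinarith
    exact_mod_cast this
  have hA := pow_sub_le_choose_mul_factorial (N + 1) k (by omega) (by omega)
  have hB : ((N * b).choose k : ℝ) * k.factorial ≤ (N * b : ℝ) ^ k := by
    have h := Nat.descFactorial_le_pow (N * b) k
    rw [Nat.descFactorial_eq_factorial_mul_choose, mul_comm] at h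
    exact_mod_cast h
  have hpos : (0 : ℝ) < (N * b).choose k := by
    exact_mod_cast Nat.choose_pos (hkN.trans (Nat.le_mul_of_pos_right _ hb))
  have hf : (0 : ℝ) < k.factorial := by exact_mod_cast k.factorial_pos
  have hd1 : (0 : ℝ) ≤ 1 - δ := by linarith
  have hbern := one_add_mul_le_pow (a := -δ) (by linarith) k
  have hkN' : (0 : ℝ) ≤ N - k := by rw [sub_nonneg]; exact_mod_cast hkN
  rw [le_div_iff₀ hpos]
  refine le_of_mul_le_mul_right ?_ hf
  calc (1 - k * δ) * (N * b).choose k * k.factorial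
      ≤ (1 - δ) ^ k * (N * b).choose k * k.factorial := by
        gcongr
        calc 1 - k * δ = 1 + k * -δ := by ring
          _ ≤ _ := hbern
          _ = _ := by ring
    _ = (1 - δ) ^ k * ((N * b).choose k * k.factorial) := by ring
    _ ≤ (1 - δ) ^ k * (N * b : ℝ) ^ k := by gcongr
    _ = (b : ℝ) ^ k * ((1 - δ) * N) ^ k := by rw [mul_pow, mul_pow]; ring
    _ ≤ (b : ℝ) ^ k * (N + 1 - k) ^ k := by gcongr; linarith
    _ ≤ (b : ℝ) ^ k * (N.choose k * k.factorial) := by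
        gcongr
        simpa using hA
    _ = (b : ℝ) ^ k * N.choose k * k.factorial := by ring

/-! ### Concatenations and inflations of words -/

/-- The word whose `i`-th block of length `L` is a copy of `α i`, the blocks being stacked
increasingly. -/
def concatWord {L : ℕ} [NeZero L] (α : ℕ → Equiv.Perm (Fin L)) (x : ℕ) : ℕ :=
  L * (x / L) + α (x / L) (Fin.ofNat L x)

lemma concatWord_block {L : ℕ} [NeZero L] (α : ℕ → Equiv.Perm (Fin L)) (i : ℕ) (x : Fin L) :
    concatWord α (i * L + x) = L * i + α i x := by
  have hL : 0 < L := NeZero.pos L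
  have h1 : (i * L + x) / L = i := by
    rw [mul_comm, Nat.mul_add_div hL, Nat.div_eq_of_lt x.2, add_zero]
  have h2 : Fin.ofNat L (i * L + x) = x := by
    ext; simp [Nat.mod_eq_of_lt x.2]
  rw [concatWord, h1, h2]

lemma concatWord_lt_iff {L : ℕ} [NeZero L] (α : ℕ → Equiv.Perm (Fin L)) (i : ℕ) (x y : Fin L) :
    concatWord α (i * L + x) < concatWord α (i * L + y) ↔ α i x < α i y := by
  rw [concatWord_block, concatWord_block, Nat.add_lt_add_iff_left, Fin.lt_def]

lemma exists_eq_mul_add {L : ℕ} [NeZero L] (x : ℕ) : ∃ (i : ℕ) (y : Fin L), x = i * L + y :=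
  ⟨x / L, ⟨x % L, Nat.mod_lt _ (NeZero.pos L)⟩, (Nat.div_add_mod' x L).symm⟩

lemma concatWord_injective {L : ℕ} [NeZero L] (α : ℕ → Equiv.Perm (Fin L)) :
    Function.Injective (concatWord α) := by
  have hL : 0 < L := NeZero.pos L
  intro x y h
  obtain ⟨i, a, rfl⟩ := exists_eq_mul_add (L := L) x
  obtain ⟨j, b, rfl⟩ := exists_eq_mul_add (L := L) y
  rw [concatWord_block, concatWord_block] at h
  have key : ∀ (i : ℕ) (z : Fin L), (L * i + z) / L = i := fun i z => by
    rw [Nat.mul_add_div hL, Nat.div_eq_of_lt z.2, add_zero]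
  have hij : i = j := by rw [← key i (α i a), h, key]
  subst hij
  have := (α i).injective (Fin.ext (Nat.add_left_cancel h))
  rw [this]

/-- Inflation of the word `s` by blocks that are copies of the prefix of length `b` of `v`. -/
def inflate (s v : ℕ → ℕ) (b x : ℕ) : ℕ :=
  s (x / b) * ((Finset.range b).sup v + 1) + v (x % b)

lemma inflate_block (s v : ℕ → ℕ) {b : ℕ} (i : ℕ) {x y : ℕ} (hx : x < b) (hy : y < b) :
    inflate s v b (i * b + x) < inflate s v b (i * b + y) ↔ v x < v y := by
  have hb : 0 < b := by omega
  have key : ∀ x < b, (i * b + x) / b = i := fun x hx => by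
    rw [mul_comm, Nat.mul_add_div hb, Nat.div_eq_of_lt hx, add_zero]
  have key' : ∀ x < b, (i * b + x) % b = x := fun x hx => by
    rw [mul_comm, Nat.mul_add_mod, Nat.mod_eq_of_lt hx]
  simp only [inflate, key x hx, key y hy, key' x hx, key' y hy, Nat.add_lt_add_iff_left]

lemma inflate_lt_inflate {s v : ℕ → ℕ} {b : ℕ} (hb : 0 < b) {x y : ℕ}
    (h : s (x / b) < s (y / b)) : inflate s v b x < inflate s v b y := by
  have h1 : v (x % b) ≤ (Finset.range b).sup v :=
    Finset.le_sup (Finset.mem_range.2 (Nat.mod_lt _ hb))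
  have h2 := Nat.mul_le_mul_right ((Finset.range b).sup v + 1) (Nat.succ_le_of_lt h)
  rw [Nat.succ_mul] at h2
  unfold inflate
  omega

lemma inflate_lt_iff {s v : ℕ → ℕ} {b : ℕ} (hb : 0 < b) (hs : Function.Injective s) {x y : ℕ}
    (h : x / b ≠ y / b) : inflate s v b x < inflate s v b y ↔ s (x / b) < s (y / b) := by
  refine ⟨fun hlt => ?_, inflate_lt_inflate hb⟩
  rcases lt_trichotomy (s (x / b)) (s (y / b)) with h1 | h1 | h1
  · exact h1
  · exact absurd (hs h1) h
  · exact absurd hlt (inflate_lt_inflate hb h1).asymm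

lemma inflate_injective {s v : ℕ → ℕ} (hs : Function.Injective s) (hv : Function.Injective v)
    (b : ℕ) : Function.Injective (inflate s v b) := by
  intro x y h
  -- For `b = 0` the conventions `x / 0 = 0` and `x % 0 = x` make the inflation a translate of `v`.
  -- This case occurs when `w n < u`.
  rcases Nat.eq_zero_or_pos b with rfl | hb
  · simpa [inflate] using hv (by simpa [inflate] using h)
  by_cases hxy : x / b = y / b
  · have : v (x % b) = v (y % b) := by
      unfold inflate at h
      rw [hxy] at h
      omega
    rw [← Nat.div_add_mod x b, ← Nat.div_add_mod y b, hxy, hv this]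
  · exfalso
    rcases lt_or_gt_of_ne (hs.ne hxy) with h1 | h1
    · exact (inflate_lt_inflate hb h1).ne h
    · exact (inflate_lt_inflate hb h1).ne' h

/-- The inflation inherits from `s` an order pattern of period `N * b`, so long prefixes consist
mostly of identical blocks. -/
lemma inflate_shift {s v : ℕ → ℕ} {N b : ℕ} (hb : 0 < b) (hs : Function.Injective s)
    (hper : ∀ i, ∀ x < N, ∀ y < N, s (i * N + x) < s (i * N + y) ↔ s x < s y)
    (i x : ℕ) (hx : x < N * b) (y : ℕ) (hy : y < N * b) :
    inflate s v b (i * (N * b) + x) < inflate s v b (i * (N * b) + y) ↔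
      inflate s v b x < inflate s v b y := by
  have hdiv : ∀ z, (i * (N * b) + z) / b = i * N + z / b := fun z => by
    rw [← mul_assoc, mul_comm _ b, Nat.mul_add_div hb]
  have hmod : ∀ z, (i * (N * b) + z) % b = z % b := fun z => by
    rw [← mul_assoc, mul_comm _ b, Nat.mul_add_mod]
  by_cases hxy : x / b = y / b
  · simp only [inflate, hdiv, hmod, hxy, Nat.add_lt_add_iff_left]
  · rw [inflate_lt_iff hb hs hxy, inflate_lt_iff hb hs (by rw [hdiv, hdiv]; omega), hdiv, hdiv,
      hper _ _ (Nat.div_lt_of_lt_mul (by rwa [mul_comm])) _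
        (Nat.div_lt_of_lt_mul (by rwa [mul_comm]))]

/-- Densities at scale `w` of the inflation of a periodic word by blocks of length `w / u`. -/
lemma abs_wordDensity_inflate_sub_le {s v : ℕ → ℕ} {N b u w ℓ : ℕ} {δ : ℝ} (hδ : δ ≤ 1 / 2)
    (hN : 0 < N) (hu : 0 < u) (hs : Function.Injective s)
    (hper : ∀ i, ∀ x < N, ∀ y < N, s (i * N + x) < s (i * N + y) ↔ s x < s y)
    (hb : 0 < b) (hbw : b = w / u) (h1 : (u : ℝ) / N ≤ δ) (h3 : (u : ℝ) / w ≤ δ)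
    (hℓ : N * b ≤ ℓ) (π : FinPerm) (h2 : (π.length : ℝ) / u ≤ δ) :
    |wordDensity (inflate s v b) ℓ w π - wordDensity s N u π| ≤
      ((N * b : ℕ) : ℝ) / ℓ + 2 * (π.length + 1) * δ := by
  have hbu : b * u ≤ w := by rw [hbw]; exact Nat.div_mul_le_self w u
  have hur : (0 : ℝ) < u := by exact_mod_cast hu
  have hNr : (0 : ℝ) < N := by exact_mod_cast hN
  have hbr : (0 : ℝ) < b := by exact_mod_cast hb
  have hu' : u ≤ w := (Nat.le_mul_of_pos_left u hb).trans hbu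
  have hwr : (0 : ℝ) < w := by exact_mod_cast hu.trans_le hu'
  have hlen : π.length ≤ w := by
    rw [div_le_iff₀ hur] at h2
    have : (π.length : ℝ) ≤ u := by nlinarith
    exact le_trans (by exact_mod_cast this) hu'
  have A := abs_wordDensity_sub_le_add (v := inflate s v b) (u := inflate s v b)
    (Nat.mul_pos hN hb) hℓ (inflate_shift hb hs hper) π hlen
  have B := abs_wordDensity_sub_le_of_inflation (v := inflate s v b) (s := s) (N := N) hb hbu
    (fun x _ y _ hxy => inflate_lt_iff hb hs hxy) π
  have C := one_sub_le_card_ratio (by linarith) hb hN hu hbw h1 h2 h3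
  -- Rounding loses at most a factor two, `w ≤ 2 * (b * u)`, and `u / N ≤ δ`.
  have D : (w : ℝ) / (N * b : ℕ) ≤ 2 * δ := by
    have e1 : (w : ℝ) ≤ 2 * (b * u) := by
      have h4 := Nat.div_add_mod w u
      have h5 := Nat.mod_lt w hu
      rw [← hbw] at h4
      have h6 : u ≤ b * u := Nat.le_mul_of_pos_left u hb
      have : w ≤ 2 * (b * u) := by rw [mul_comm] at h4; omega
      exact_mod_cast this
    rw [div_le_iff₀ hNr] at h1
    rw [div_le_iff₀ (by positivity)]
    push_cast
    nlinarith
  have := abs_sub_le (wordDensity (inflate s v b) ℓ w π)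
    (wordDensity (inflate s v b) (N * b) w π) (wordDensity s N u π)
  linarith

/-! ### Attaining finitely many densities, one scale at a time -/

/-- A pattern density that is to be attained asymptotically: a scale, a pattern, and the limit. -/
abbrev ScaleTarget : Type := (ℕ → ℕ) × FinPerm × ℝ

/-- `w(n) / ℓ(n) → 0` for sequences of natural numbers. -/
def IsNegligible (w ℓ : ℕ → ℕ) : Prop :=
  Tendsto (fun n => (w n : ℝ) / (ℓ n : ℝ)) atTop (𝓝 0)

/-- The targets in `S` can be attained simultaneously, to any precision, by words whose prefixes
of all lengths much larger than the scales in `S` have the required densities. -/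
def Attainable (S : Set ScaleTarget) : Prop :=
  (∀ c ∈ S, ∀ᶠ n in atTop, c.2.1.length ≤ c.1 n) ∧
    ∀ ε > 0, ∃ v : ℕ → ℕ → ℕ, (∀ n, Function.Injective (v n)) ∧
      ∀ ℓ : ℕ → ℕ, Tendsto ℓ atTop atTop → (∀ c ∈ S, IsNegligible c.1 ℓ) →
        ∀ c ∈ S, ∀ᶠ n in atTop, |wordDensity (v n) (ℓ n) (c.1 n) c.2.1 - c.2.2| < ε

lemma IsScalingFunction.tendsto_atTop {f : ℕ → ℝ} (hf : IsScalingFunction f) :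
    Tendsto f atTop atTop := by
  have h1 : Tendsto (fun n => 1 / f n) atTop (𝓝[>] 0) :=
    tendsto_nhdsWithin_iff.2 ⟨hf.one_dominated, by
      filter_upwards [eventually_ge_atTop 1] with n hn
      exact one_div_pos.2 (hf.pos n hn)⟩
  refine h1.inv_tendsto_nhdsGT_zero.congr fun n => ?_
  simp

lemma IsScalingFunction.tendsto_floor {f : ℕ → ℝ} (hf : IsScalingFunction f) :
    Tendsto (fun n => ⌊f n⌋₊) atTop atTop :=
  tendsto_nat_floor_atTop.comp hf.tendsto_atTop

/-- A convergent sequence at some scale contains permutations with the limiting densities at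
widths that are large but small compared to the length. -/
lemma IsScaleLimit.exists_perm {Ξ : FinPerm → ℝ} (hΞ : IsScaleLimit Ξ) (F : Finset FinPerm)
    {ε δ : ℝ} (hε : 0 < ε) (hδ : 0 < δ) :
    ∃ (N u : ℕ) (s : ℕ → ℕ), 0 < N ∧ 0 < u ∧ Function.Injective s ∧
      (∀ i, ∀ x < N, ∀ y < N, s (i * N + x) < s (i * N + y) ↔ s x < s y) ∧
      (u : ℝ) / N ≤ δ ∧
      ∀ π ∈ F, (π.length : ℝ) / u ≤ δ ∧ |wordDensity s N u π - Ξ π| < ε := by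
  obtain ⟨g, hg, σ, hσ, hlim⟩ := hΞ
  have hu : Tendsto (fun j => ⌊g (σ j).length⌋₊) atTop atTop := hg.tendsto_floor.comp hσ
  have e1 : ∀ᶠ j in atTop, 0 < (σ j).length := hσ.eventually_gt_atTop 0
  have e2 : ∀ᶠ j in atTop, 0 < ⌊g (σ j).length⌋₊ := hu.eventually_gt_atTop 0
  have e3 : ∀ᶠ j in atTop, g (σ j).length / (σ j).length < δ :=
    (hg.dominated_self.comp hσ).eventually (gt_mem_nhds hδ)
  have e4 : ∀ᶠ j in atTop, ∀ π ∈ F, (π.length : ℝ) / ⌊g (σ j).length⌋₊ ≤ δ ∧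
      |FinPerm.scaleDensity (g (σ j).length) π (σ j) - Ξ π| < ε := by
    rw [Finset.eventually_all]
    intro π _
    have h1 : Tendsto (fun j => (π.length : ℝ) / ⌊g (σ j).length⌋₊) atTop (𝓝 0) :=
      tendsto_const_nhds.div_atTop (tendsto_natCast_atTop_atTop.comp hu)
    filter_upwards [h1.eventually (gt_mem_nhds hδ), Metric.tendsto_nhds.1 (hlim π) ε hε]
      with j h h'
    exact ⟨h.le, by rwa [Real.dist_eq] at h'⟩
  obtain ⟨j, h1, h2, h3, h4⟩ := (e1.and (e2.and (e3.and e4))).exists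
  generalize σ j = τ at *
  obtain ⟨N, τ⟩ := τ
  dsimp only [FinPerm.length] at h1 h2 h3 h4
  have : NeZero N := ⟨h1.ne'⟩
  have hg0 : 0 ≤ g N := (hg.pos N h1).le
  refine ⟨N, ⌊g N⌋₊, concatWord fun _ => τ, h1, h2, concatWord_injective _, ?_, ?_, ?_⟩
  · intro i x hx y hy
    have a := concatWord_lt_iff (fun _ => τ) i ⟨x, hx⟩ ⟨y, hy⟩
    have b := concatWord_lt_iff (fun _ => τ) 0 ⟨x, hx⟩ ⟨y, hy⟩
    simp only [zero_mul, zero_add] at a b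
    rw [a, b]
  · refine le_trans ?_ h3.le
    gcongr
    exact Nat.floor_le hg0
  · intro π hπ
    refine ⟨(h4 π hπ).1, ?_⟩
    rw [← scaleDensity_eq_wordDensity (σ := ⟨N, τ⟩) (v := concatWord fun _ => τ) ?_ hg0 π]
    · exact (h4 π hπ).2
    · intro a b
      have := concatWord_lt_iff (fun _ => τ) 0 a b
      simpa using this.symm

lemma tendsto_div_const_atTop {w : ℕ → ℕ} (hw : Tendsto w atTop atTop) {u : ℕ} (hu : 0 < u) :
    Tendsto (fun n => w n / u) atTop atTop :=
  (Nat.tendsto_div_const_atTop hu.ne').comp hw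

lemma IsNegligible.div_const {c w : ℕ → ℕ} (h : IsNegligible c w) (hw : Tendsto w atTop atTop)
    {u : ℕ} (hu : 0 < u) : IsNegligible c fun n => w n / u := by
  have h2 : Tendsto (fun n => 2 * (u : ℝ) * ((c n : ℝ) / w n)) atTop (𝓝 0) := by
    simpa using h.const_mul (2 * (u : ℝ))
  refine squeeze_zero' (Eventually.of_forall fun n => by positivity) ?_ h2
  filter_upwards [hw.eventually_ge_atTop u] with n hn
  have hb : 0 < w n / u := Nat.div_pos hn hu
  have hw0 : 0 < w n := by omega
  have h3 : w n ≤ 2 * u * (w n / u) := by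
    have h4 := Nat.div_add_mod (w n) u
    have h5 := Nat.mod_lt (w n) hu
    have h6 : u ≤ u * (w n / u) := Nat.le_mul_of_pos_right u hb
    rw [mul_assoc]
    omega
  have h3' : (w n : ℝ) ≤ 2 * u * (w n / u : ℕ) := by exact_mod_cast h3
  have hb' : (0 : ℝ) < (w n / u : ℕ) := by exact_mod_cast hb
  have hw' : (0 : ℝ) < w n := by exact_mod_cast hw0
  have hc : (0 : ℝ) ≤ c n := by positivity
  rw [mul_div_assoc', div_le_div_iff₀ hb' hw']
  nlinarith

lemma IsNegligible.of_le {w w' ℓ : ℕ → ℕ} (h : IsNegligible w ℓ) (hle : ∀ n, w' n ≤ w n) :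
    IsNegligible w' ℓ :=
  squeeze_zero (fun n => by positivity) (fun n => by gcongr; exact hle n) h

lemma IsNegligible.const_mul {w ℓ : ℕ → ℕ} (h : IsNegligible w ℓ) (N : ℕ) :
    IsNegligible (fun n => N * w n) ℓ := by
  have := Tendsto.const_mul (N : ℝ) h
  rw [mul_zero] at this
  refine this.congr fun n => ?_
  push_cast
  ring

lemma IsNegligible.eventually_le {w ℓ : ℕ → ℕ} (h : IsNegligible w ℓ)
    (hℓ : Tendsto ℓ atTop atTop) : ∀ᶠ n in atTop, w n ≤ ℓ n := by
  filter_upwards [h.eventually (gt_mem_nhds one_pos), hℓ.eventually_gt_atTop 0] with n h1 h2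
  rw [div_lt_one (by exact_mod_cast h2)] at h1
  exact_mod_cast h1.le

lemma exists_forall_length_mul_le (F : Finset FinPerm) {ε : ℝ} (hε : 0 < ε) :
    ∃ δ : ℝ, 0 < δ ∧ δ ≤ 1 / 2 ∧ ∀ π ∈ F, 2 * ((π.length : ℝ) + 1) * δ ≤ ε := by
  obtain ⟨K, hK⟩ : ∃ K : ℕ, ∀ π ∈ F, π.length ≤ K :=
    ⟨F.sup FinPerm.length, fun π hπ => Finset.le_sup (f := FinPerm.length) hπ⟩
  refine ⟨min (1 / 2) (ε / (2 * (K + 1))), lt_min (by norm_num) (by positivity),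
    min_le_left _ _, fun π hπ => ?_⟩
  have h1 : (π.length : ℝ) ≤ K := by exact_mod_cast hK π hπ
  have h2 : min (1 / 2) (ε / (2 * (K + 1))) ≤ ε / (2 * ((K : ℝ) + 1)) := min_le_right _ _
  rw [le_div_iff₀ (by positivity)] at h2
  have h3 : (0 : ℝ) ≤ min (1 / 2) (ε / (2 * (K + 1))) := le_min (by norm_num) (by positivity)
  nlinarith

/-- A larger scale can be added to a family of attainable targets. -/
theorem Attainable.union_scale {S : Set ScaleTarget} (hS : Attainable S) {w : ℕ → ℕ}
    (hw : Tendsto w atTop atTop) (hSw : ∀ c ∈ S, IsNegligible c.1 w) {Ξ : FinPerm → ℝ}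
    (hΞ : IsScaleLimit Ξ) (F : Finset FinPerm) :
    Attainable (S ∪ (fun π => (w, π, Ξ π)) '' (F : Set FinPerm)) := by
  -- Some target at scale `w` is needed below to know that `w` is negligible against `ℓ`.
  rcases F.eq_empty_or_nonempty with rfl | ⟨π₀, hπ₀⟩
  · simpa using hS
  obtain ⟨hS1, hS2⟩ := hS
  refine ⟨?_, fun ε hε => ?_⟩
  · rintro c (hc | ⟨π, -, rfl⟩)
    · exact hS1 c hc
    · exact hw.eventually_ge_atTop _
  obtain ⟨v, hv, hvS⟩ := hS2 (ε / 2) (by linarith)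
  obtain ⟨δ, hδ, hδ1, hδ2⟩ := exists_forall_length_mul_le F (ε := ε / 4) (by linarith)
  obtain ⟨N, u, s, hN, hu, hs, hper, huN, hsF⟩ :=
    hΞ.exists_perm F (ε := ε / 4) (by linarith) hδ
  have hb : Tendsto (fun n => w n / u) atTop atTop := tendsto_div_const_atTop hw hu
  have hSb : ∀ c ∈ S, IsNegligible c.1 fun n => w n / u := fun c hc =>
    (hSw c hc).div_const hw hu
  have hvb := hvS _ hb hSb
  -- With blocks of length `w n / u`, a window of width `w n` spans about `u` blocks, which is the
  -- width at which `s` is close to `Ξ`.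
  refine ⟨fun n => inflate s (v n) (w n / u), fun n => inflate_injective hs (hv n) _, ?_⟩
  intro ℓ hℓ hneg
  have hwℓ : IsNegligible w ℓ := hneg (w, π₀, Ξ π₀) (Or.inr ⟨π₀, hπ₀, rfl⟩)
  have hbℓ : IsNegligible (fun n => w n / u) ℓ := hwℓ.of_le fun n => Nat.div_le_self _ _
  rintro c (hc | ⟨π, hπ, rfl⟩)
  -- Earlier scales: `ε / 2` from the words `v`, and `ε / 4` each for the last partial block and for
  -- block boundaries.
  · have h1 := hbℓ.eventually (gt_mem_nhds (show (0 : ℝ) < ε / 4 by linarith))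
    have h2 := (hSb c hc).eventually (gt_mem_nhds (show (0 : ℝ) < ε / 4 by linarith))
    filter_upwards [hvb c hc, h1, h2, hS1 c hc, hb.eventually_gt_atTop 0,
      hbℓ.eventually_le hℓ] with n a1 a2 a3 a4 a5 a6
    have A := abs_wordDensity_sub_le_add (v := inflate s (v n) (w n / u)) a5 a6
      (fun i x hx y hy => inflate_block s (v n) i hx hy) c.2.1 a4
    have := abs_sub_le (wordDensity (inflate s (v n) (w n / u)) (ℓ n) (c.1 n) c.2.1)
      (wordDensity (v n) (w n / u) (c.1 n) c.2.1) c.2.2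
    linarith
  · have hNb : IsNegligible (fun n => N * (w n / u)) ℓ := hbℓ.const_mul N
    have h1 := hNb.eventually (gt_mem_nhds (show (0 : ℝ) < ε / 4 by linarith))
    have h2 : Tendsto (fun n => (u : ℝ) / w n) atTop (𝓝 0) :=
      tendsto_const_nhds.div_atTop (tendsto_natCast_atTop_atTop.comp hw)
    filter_upwards [h1, h2.eventually (gt_mem_nhds hδ), hb.eventually_gt_atTop 0,
      hNb.eventually_le hℓ] with n a1 a2 a3 a4
    have A := abs_wordDensity_inflate_sub_le (v := v n) hδ1 hN hu hs hper a3 rfl huN a2.le a4 π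
      (hsF π hπ).1
    have B := (hsF π hπ).2
    have C := hδ2 π hπ
    have := abs_sub_le (wordDensity (inflate s (v n) (w n / u)) (ℓ n) (w n) π)
      (wordDensity s N u π) (Ξ π)
    linarith

/-- Attainable targets can be attained together with given global densities. -/
theorem Attainable.exists_word {S : Set ScaleTarget} (hS : Attainable S) (hfin : S.Finite)
    (hSn : ∀ c ∈ S, IsNegligible c.1 id) {ρ : FinPerm → ℝ} (F : Finset FinPerm)
    (hρ : ∀ ε > 0, ∀ M₀ : ℕ, ∃ M ≥ M₀, ∃ s : ℕ → ℕ, Function.Injective s ∧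
      ∀ π ∈ F, |wordDensity s M M π - ρ π| < ε)
    {ε : ℝ} (hε : 0 < ε) (n₀ : ℕ) :
    ∃ n ≥ n₀, ∃ v : ℕ → ℕ, Function.Injective v ∧
      (∀ c ∈ S, |wordDensity v n (c.1 n) c.2.1 - c.2.2| < ε) ∧
      ∀ π ∈ F, |wordDensity v n n π - ρ π| < ε := by
  obtain ⟨hS1, hS2⟩ := hS
  obtain ⟨v, hv, hvS⟩ := hS2 (ε / 2) (by linarith)
  obtain ⟨δ, hδ, hδ1, hδ2⟩ := exists_forall_length_mul_le F (ε := ε / 2) (by linarith)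
  obtain ⟨K, hK⟩ : ∃ K : ℕ, ∀ π ∈ F, π.length ≤ K :=
    ⟨F.sup FinPerm.length, fun π hπ => Finset.le_sup (f := FinPerm.length) hπ⟩
  -- `M` must be large against all pattern lengths, so that most tuples meet distinct blocks.
  obtain ⟨M₁, hM₁⟩ := exists_nat_gt ((K : ℝ) / δ)
  obtain ⟨M, hM, s, hs, hsF⟩ := hρ (ε / 2) (by linarith) (M₁ + 1)
  have hM0 : 0 < M := by omega
  have hMr : (0 : ℝ) < M := by exact_mod_cast hM0
  have hKM : (K : ℝ) / M ≤ δ := by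
    have : (M₁ : ℝ) ≤ M := by exact_mod_cast (by omega : M₁ ≤ M)
    rw [div_lt_iff₀ hδ] at hM₁
    rw [div_le_iff₀ hMr]
    nlinarith
  have hb : Tendsto (fun n => n / M) atTop atTop := tendsto_div_const_atTop tendsto_id hM0
  have hSb : ∀ c ∈ S, IsNegligible c.1 fun n => n / M := fun c hc =>
    (hSn c hc).div_const tendsto_id hM0
  have h1 : ∀ᶠ n in atTop, ∀ c ∈ S, |wordDensity (v n) (n / M) (c.1 n) c.2.1 - c.2.2| < ε / 2 ∧
      ((c.1 n : ℕ) : ℝ) / (n / M : ℕ) < ε / 2 ∧ c.2.1.length ≤ c.1 n := by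
    rw [hfin.eventually_all]
    exact fun c hc => (hvS _ hb hSb c hc).and (((hSb c hc).eventually
      (gt_mem_nhds (show (0 : ℝ) < ε / 2 by linarith))).and (hS1 c hc))
  obtain ⟨n₁, hn₁⟩ := eventually_atTop.1 h1
  -- The length is taken to be `M * b`, so the `M` blocks tile the word without remainder.
  set b := n₀ + n₁ + 1 with hbdef
  have hb0 : 0 < b := by omega
  have hbn : b ≤ M * b := Nat.le_mul_of_pos_left b hM0
  have hdiv : M * b / M = b := Nat.mul_div_cancel_left b hM0
  have hn := hn₁ (M * b) (by omega)
  rw [hdiv] at hn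
  refine ⟨M * b, by omega, inflate s (v (M * b)) b, inflate_injective hs (hv _) _, ?_, ?_⟩
  · intro c hc
    obtain ⟨a1, a2, a3⟩ := hn c hc
    have A := abs_wordDensity_sub_le_of_blocks (v := inflate s (v (M * b)) b) hb0 hM0 le_rfl
      (fun i _ x hx y hy => inflate_block s (v (M * b)) i hx hy) c.2.1 a3
    have e : (1 : ℝ) - M * ((b : ℝ) - c.1 (M * b)) / (M * b : ℕ) = (c.1 (M * b) : ℝ) / b := by
      have : (b : ℝ) ≠ 0 := by positivity
      push_cast
      field_simp
      ring
    rw [e] at A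
    have := abs_sub_le (wordDensity (inflate s (v (M * b)) b) (M * b) (c.1 (M * b)) c.2.1)
      (wordDensity (v (M * b)) b (c.1 (M * b)) c.2.1) c.2.2
    linarith
  · intro π hπ
    have B := abs_wordDensity_sub_le_of_inflation (v := inflate s (v (M * b)) b) (s := s)
      (N := M) (u := M) (w := M * b) hb0 (mul_comm b M).le
      (fun x _ y _ hxy => inflate_lt_iff hb0 hs hxy) π
    have hπM : (π.length : ℝ) / M ≤ δ := by
      refine le_trans ?_ hKM
      gcongr
      exact hK π hπ
    have C := one_sub_le_card_ratio_self (by linarith) hb0 hM0 hπM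
    have D := hδ2 π hπ
    have E := hsF π hπ
    have hπ0 : 0 ≤ ((π.length : ℝ) + 2) * δ := by positivity
    have := abs_sub_le (wordDensity (inflate s (v (M * b)) b) (M * b) (M * b) π)
      (wordDensity s M M π) (ρ π)
    linarith

/-! ### Finite permutations approximating a local limit -/

lemma exists_perm_of_injective {β : Type*} [LinearOrder β] {n : ℕ} {h : Fin n → β}
    (hh : Function.Injective h) :
    ∃ σ : Equiv.Perm (Fin n), ∀ i j, σ i < σ j ↔ h i < h j := by
  classical
  have hcard : (Finset.univ.image h).card = n := by
    rw [Finset.card_image_of_injective _ hh]; simp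
  let e := (Finset.univ.image h).orderIsoOfFin hcard
  let f : Fin n → Fin n := fun i => e.symm ⟨h i, Finset.mem_image_of_mem _ (Finset.mem_univ i)⟩
  have hf : ∀ i j, f i < f j ↔ h i < h j := fun i j => by
    simp only [f, OrderIso.lt_iff_lt, Subtype.mk_lt_mk]
  have hinj : Function.Injective f := fun i j hij => hh (by
    have h1 := hf i j
    have h2 := hf j i
    rw [hij] at h1 h2
    exact le_antisymm (not_lt.1 fun h => (h2.2 h).ne rfl) (not_lt.1 fun h => (h1.2 h).ne rfl))
  exact ⟨Equiv.ofBijective f (Finite.injective_iff_bijective.1 hinj), hf⟩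

lemma exists_perm_of_total_order {n : ℕ} {r : Fin n → Fin n → Prop}
    (htrans : ∀ i j k, r i j → r j k → r i k) (hanti : ∀ i j, r i j → r j i → i = j)
    (htotal : ∀ i j, r i j ∨ r j i) :
    ∃ σ : Equiv.Perm (Fin n), ∀ i j, r i j ↔ σ i ≤ σ j := by
  classical
  have key : ∀ i j, ¬ r i j → (Finset.univ.filter fun k => r k j).card <
      (Finset.univ.filter fun k => r k i).card := by
    intro i j hij
    have hji : r j i := (htotal i j).resolve_left hij
    refine Finset.card_lt_card ((Finset.ssubset_iff_of_subset ?_).2 ⟨i, ?_, ?_⟩)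
    · intro k hk
      rw [Finset.mem_filter] at hk ⊢
      exact ⟨hk.1, htrans _ _ _ hk.2 hji⟩
    · simpa using htotal i i
    · simpa using hij
  have hle : ∀ i j, r i j → (Finset.univ.filter fun k => r k i).card ≤
      (Finset.univ.filter fun k => r k j).card := by
    intro i j hij
    refine Finset.card_le_card fun k hk => ?_
    rw [Finset.mem_filter] at hk ⊢
    exact ⟨hk.1, htrans _ _ _ hk.2 hij⟩
  -- Elements are ranked by their number of predecessors.
  obtain ⟨σ, hσ⟩ := exists_perm_of_injective
    (h := fun i => (Finset.univ.filter fun k => r k i).card) (fun i j hij => by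
      by_contra hne
      rcases not_and_or.1 (fun h : r i j ∧ r j i => hne (hanti _ _ h.1 h.2)) with h | h
      · exact (key _ _ h).ne' hij
      · exact (key _ _ h).ne hij)
  refine ⟨σ, fun i j => ?_⟩
  rw [← not_lt, hσ, not_lt]
  exact ⟨hle i j, fun h => by_contra fun hn => (key i j hn).not_ge h⟩

/-- A finitely supported probability vector is approximated by averages over finite sequences. -/
lemma exists_sequence_average {A ι : Type*} [Fintype A] [Nonempty A] {p : A → ℝ}
    (hp : ∀ a, 0 ≤ p a) (hsum : ∑ a, p a = 1) (F : Finset ι) (h : ι → A → ℝ) {ε : ℝ}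
    (hε : 0 < ε) :
    ∃ (Q : ℕ) (α : ℕ → A), 0 < Q ∧
      ∀ i ∈ F, |(∑ j ∈ Finset.range Q, h i (α j)) / Q - ∑ a, p a * h i a| < ε := by
  classical
  -- Multiplicities of the values. The sequence used has length `∑ a, m Q a`, which may be smaller
  -- than `Q` because of rounding.
  let m : ℕ → A → ℕ := fun Q a => ⌊p a * (Q : ℝ)⌋₊
  have hm : ∀ a, Tendsto (fun Q : ℕ => (m Q a : ℝ) / Q) atTop (𝓝 (p a)) := fun a =>
    (tendsto_nat_floor_mul_div_atTop (hp a)).comp tendsto_natCast_atTop_atTop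
  have hT : Tendsto (fun Q : ℕ => ∑ a, (m Q a : ℝ) / Q) atTop (𝓝 1) := by
    rw [← hsum]; exact tendsto_finsetSum _ fun a _ => hm a
  have hlim : ∀ i, Tendsto (fun Q : ℕ => (∑ a, (m Q a : ℝ) * h i a) / ∑ a, (m Q a : ℝ)) atTop
      (𝓝 (∑ a, p a * h i a)) := by
    intro i
    have h1 : Tendsto (fun Q : ℕ => ∑ a, (m Q a : ℝ) / Q * h i a) atTop
        (𝓝 (∑ a, p a * h i a)) := tendsto_finsetSum _ fun a _ => (hm a).mul_const _
    have h2 := h1.div hT one_ne_zero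
    rw [div_one] at h2
    refine h2.congr' ?_
    filter_upwards [eventually_gt_atTop 0] with Q hQ
    have hQ' : (Q : ℝ) ≠ 0 := by positivity
    have e1 : ∑ a, (m Q a : ℝ) / Q * h i a = (∑ a, (m Q a : ℝ) * h i a) / Q := by
      rw [Finset.sum_div]; exact Finset.sum_congr rfl fun a _ => by ring
    rw [Pi.div_apply, e1, ← Finset.sum_div, div_div_div_cancel_right₀ hQ']
  have hev : ∀ᶠ Q in atTop, ∀ i ∈ F,
      |(∑ a, (m Q a : ℝ) * h i a) / ∑ a, (m Q a : ℝ) - ∑ a, p a * h i a| < ε := by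
    rw [Finset.eventually_all]
    intro i _
    filter_upwards [Metric.tendsto_nhds.1 (hlim i) ε hε] with Q hQ
    rwa [Real.dist_eq] at hQ
  have hpos : ∀ᶠ Q in atTop, 0 < ∑ a, (m Q a : ℝ) / Q :=
    hT.eventually (lt_mem_nhds one_pos)
  obtain ⟨Q, hQ1, hQ2⟩ := (hev.and hpos).exists
  have hTpos : 0 < ∑ a, m Q a := by
    rw [← Finset.sum_div] at hQ2
    by_contra h0
    have : (∑ a, (m Q a : ℝ)) = 0 := by
      rw [← Nat.cast_sum]; exact_mod_cast Nat.eq_zero_of_not_pos h0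
    rw [this, zero_div] at hQ2
    exact lt_irrefl _ hQ2
  let e : Fin (∑ a, m Q a) ≃ (Σ a, Fin (m Q a)) :=
    (Fintype.equivFinOfCardEq (by simp)).symm
  refine ⟨∑ a, m Q a,
    fun j => if hj : j < ∑ a, m Q a then (e ⟨j, hj⟩).1 else Classical.arbitrary A, hTpos, ?_⟩
  intro i hi
  have hsum' : ∑ j ∈ Finset.range (∑ a, m Q a), h i
      (if hj : j < ∑ a, m Q a then (e ⟨j, hj⟩).1 else Classical.arbitrary A) =
      ∑ a, (m Q a : ℝ) * h i a := by
    rw [Finset.sum_range]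
    have : ∀ j : Fin (∑ a, m Q a), h i (if hj : (j : ℕ) < ∑ a, m Q a then (e ⟨j, hj⟩).1
        else Classical.arbitrary A) = h i (e j).1 := fun j => by rw [dif_pos j.2]
    simp only [this]
    rw [e.sum_comp (fun s => h i s.1), Fintype.sum_sigma]
    simp
  rw [hsum', Nat.cast_sum]
  exact hQ1 i hi

namespace PermutationLocalLimit

/-- The event that the random order, restricted to the positions `c`, is the pattern `π`. -/
def windowEvent (π : FinPerm) (c : Fin π.length → ℤ) : Set InfiniteRootedPerm :=
  {r | ∀ a b, r.1 (c a) (c b) ↔ π.2 a ≤ π.2 b}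

lemma measurable_rel (i j : ℤ) : Measurable fun r : InfiniteRootedPerm => r.1 i j :=
  (measurable_pi_apply j).comp ((measurable_pi_apply i).comp measurable_subtype_coe)

lemma measurableSet_windowEvent (π : FinPerm) (c : Fin π.length → ℤ) :
    MeasurableSet (windowEvent π c) := by
  have : windowEvent π c = ⋂ a, ⋂ b, {r | r.1 (c a) (c b) ↔ π.2 a ≤ π.2 b} := by
    ext r; simp [windowEvent]
  rw [this]
  refine MeasurableSet.iInter fun a => MeasurableSet.iInter fun b => ?_
  exact measurable_rel (c a) (c b) (t := {p | p ↔ π.2 a ≤ π.2 b}) trivial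

lemma measurable_shift : Measurable InfiniteRootedPerm.shift := by
  refine Measurable.subtype_mk ?_
  exact measurable_pi_iff.2 fun i => measurable_pi_iff.2 fun j => measurable_rel (i + 1) (j + 1)

lemma measureReal_windowEvent (Λ : PermutationLocalLimit) (π : FinPerm) (x : ℕ) :
    Λ.measure.real (windowEvent π fun a => (x : ℤ) + (a : ℕ)) = Λ.density π := by
  induction x with
  | zero => simp [windowEvent, density]
  | succ x ih =>
    rw [← ih]
    conv_rhs => rw [← Λ.shift_invariant]
    rw [map_measureReal_apply measurable_shift (measurableSet_windowEvent _ _)]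
    congr 1
    ext r
    simp only [windowEvent, Set.mem_preimage, InfiniteRootedPerm.shift, Set.mem_ofPred_eq]
    push_cast
    simp only [add_right_comm]

/-- The law of the restriction to `{0, …, L - 1}` determines the probabilities of all patterns in
this window. -/
lemma measureReal_windowEvent_eq_sum (Λ : PermutationLocalLimit) {L : ℕ} (π : FinPerm)
    (c : Fin π.length → Fin L) [DecidablePred fun α : Equiv.Perm (Fin L) =>
      ∀ a b, α (c a) < α (c b) ↔ π.2 a < π.2 b] :
    Λ.measure.real (windowEvent π fun a => ((c a : ℕ) : ℤ)) =
      ∑ α : Equiv.Perm (Fin L) with (∀ a b, α (c a) < α (c b) ↔ π.2 a < π.2 b),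
        Λ.density ⟨L, α⟩ := by
  have := Λ.isProbabilityMeasure
  have hset : windowEvent π (fun a => ((c a : ℕ) : ℤ)) =
      ⋃ α ∈ (Finset.univ.filter fun α : Equiv.Perm (Fin L) =>
        ∀ a b, α (c a) < α (c b) ↔ π.2 a < π.2 b),
        windowEvent ⟨L, α⟩ (fun a => ((a : ℕ) : ℤ)) := by
    ext r
    simp only [windowEvent, Set.mem_ofPred_eq, Set.mem_iUnion, Finset.mem_filter,
      Finset.mem_univ, true_and, exists_prop]
    constructor
    · intro h
      obtain ⟨α, hα⟩ := exists_perm_of_total_order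
        (r := fun i j : Fin L => r.1 ((i : ℕ) : ℤ) ((j : ℕ) : ℤ))
        (fun i j k => r.2.2.1 _ _ _)
        (fun i j hij hji => Fin.ext (by exact_mod_cast r.2.2.2.1 _ _ hij hji))
        (fun i j => r.2.2.2.2 _ _)
      refine ⟨α, fun a b => ?_, hα⟩
      rw [← not_le, ← hα, h, not_le]
    · rintro ⟨α, h1, h2⟩ a b
      rw [h2 (c a) (c b), ← not_lt, h1, not_lt]
  rw [hset, measureReal_biUnion_finset ?_ fun α _ => measurableSet_windowEvent _ _]
  · rfl
  · intro α _ β _ hαβ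
    refine Set.disjoint_left.2 fun r h1 h2 => hαβ ?_
    have key : ∀ i j, α i ≤ α j ↔ β i ≤ β j := fun i j => (h1 i j).symm.trans (h2 i j)
    have hmono : StrictMono (β ∘ α.symm) := fun i j hij => by
      have := key (α.symm j) (α.symm i)
      simp only [Equiv.apply_symm_apply] at this
      exact not_le.1 fun h => (this.2 h).not_gt hij
    have hid := Subsingleton.elim
      (hmono.orderIsoOfSurjective _ (β.surjective.comp α.symm.surjective)) (OrderIso.refl _)
    ext i
    have := DFunLike.congr_fun hid (α i)
    simpa using congrArg Fin.val this.symm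

end PermutationLocalLimit

/-- A `k`-tuple of width at most `k` has no room for gaps. -/
lemma eq_add_of_mem_narrowTuples {n k : ℕ} {c : Fin k → ℕ} (hc : c ∈ narrowTuples n k k)
    (hk : 0 < k) (a : Fin k) : c a = c ⟨0, hk⟩ + a := by
  obtain ⟨-, h2, h3⟩ := mem_narrowTuples.1 hc
  have key : ∀ d : ℕ, ∀ a b : Fin k, (b : ℕ) = a + d → c a + d ≤ c b := by
    intro d
    induction d with
    | zero => intro a b h; rw [Fin.ext h]; simp
    | succ d ih =>
      intro a b h
      have := ih a ⟨a + d, by omega⟩ rfl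
      have : c ⟨a + d, by omega⟩ < c b := h2 (Fin.lt_def.2 (by simp; omega))
      omega
  have h4 := key a ⟨0, hk⟩ a (by simp)
  have h5 := key (k - 1 - a) a ⟨k - 1, by omega⟩ (by simp; omega)
  have h6 := h3 ⟨0, hk⟩ ⟨k - 1, by omega⟩
  have := a.2
  omega

namespace PermutationLocalLimit

/-- The left side is the expected local density of `π` in a random window of length `L`. By
shift-invariance each of the intervals averaged over contributes the same probability. -/
lemma sum_density_mul_wordDensity (Λ : PermutationLocalLimit) {L : ℕ} [NeZero L] (π : FinPerm)
    (hπ : 0 < π.length) (hL : π.length ≤ L) :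
    ∑ α : Equiv.Perm (Fin L), Λ.density ⟨L, α⟩ *
      wordDensity (concatWord fun _ => α) L π.length π = Λ.density π := by
  classical
  set T := narrowTuples L π.length π.length with hT
  have hTpos : (0 : ℝ) < T.card := by
    have : T.Nonempty := ⟨fun a => a, mem_narrowTuples.2
      ⟨fun a => a.2.trans_le hL, fun a b h => h, fun a b => by have := b.2; omega⟩⟩
    exact_mod_cast this.card_pos
  have hc : ∀ c ∈ T, ∑ α : Equiv.Perm (Fin L) with InducesPattern (concatWord fun _ => α) π c,
      Λ.density ⟨L, α⟩ = Λ.density π := by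
    intro c hc
    have h1 := (mem_narrowTuples.1 hc).1
    rw [← measureReal_windowEvent Λ π (c ⟨0, hπ⟩)]
    have e : (fun a : Fin π.length => ((c ⟨0, hπ⟩ : ℕ) : ℤ) + (a : ℕ)) =
        fun a => (((⟨c a, h1 a⟩ : Fin L) : ℕ) : ℤ) := by
      funext a
      have := eq_add_of_mem_narrowTuples hc hπ a
      simp only [this]
      push_cast
      rfl
    rw [e, measureReal_windowEvent_eq_sum Λ π fun a => ⟨c a, h1 a⟩]
    refine Finset.sum_congr (Finset.filter_congr fun α _ => forall₂_congr fun a b => ?_)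
      fun _ _ => rfl
    have := concatWord_lt_iff (fun _ => α) 0 ⟨c a, h1 a⟩ ⟨c b, h1 b⟩
    simp only [zero_mul, zero_add] at this
    rw [this]
  have hd : ∀ α : Equiv.Perm (Fin L), Λ.density ⟨L, α⟩ *
      wordDensity (concatWord fun _ => α) L π.length π =
      (∑ c ∈ T, if InducesPattern (concatWord fun _ => α) π c then Λ.density ⟨L, α⟩ else 0) /
        T.card := by
    intro α
    unfold wordDensity
    rw [← Finset.sum_filter, Finset.sum_const, nsmul_eq_mul, ← hT]
    rw [mul_div_assoc', mul_comm]
  rw [Finset.sum_congr rfl fun α _ => hd α, ← Finset.sum_div, Finset.sum_comm,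
    div_eq_iff hTpos.ne']
  simp only [← Finset.sum_filter]
  rw [Finset.sum_congr rfl hc, Finset.sum_const, nsmul_eq_mul, mul_comm]

lemma density_of_length_eq_zero (Λ : PermutationLocalLimit) {π : FinPerm} (h : π.length = 0) :
    Λ.density π = 1 := by
  have := Λ.isProbabilityMeasure
  obtain ⟨k, p⟩ := π
  obtain rfl : k = 0 := h
  have : {r : InfiniteRootedPerm | ∀ a b : Fin 0, r.1 ((a : ℕ) : ℤ) ((b : ℕ) : ℤ) ↔ p a ≤ p b} =
      Set.univ := Set.eq_univ_of_forall fun r a => a.elim0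
  simp only [density, FinPerm.length]
  rw [this, probReal_univ]

lemma sum_density_eq_one (Λ : PermutationLocalLimit) (L : ℕ) :
    ∑ α : Equiv.Perm (Fin L), Λ.density ⟨L, α⟩ = 1 := by
  classical
  have h := measureReal_windowEvent_eq_sum Λ (L := L) ⟨0, 1⟩ Fin.elim0
  have h2 := density_of_length_eq_zero Λ (π := ⟨0, 1⟩) rfl
  rw [← measureReal_windowEvent Λ ⟨0, 1⟩ 0] at h2
  have e : (fun a : Fin 0 => ((0 : ℕ) : ℤ) + ((a : ℕ) : ℤ)) =
      fun a : Fin 0 => (((Fin.elim0 a : Fin L) : ℕ) : ℤ) := funext fun a => a.elim0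
  have h3 : Finset.univ.filter (fun α : Equiv.Perm (Fin L) => ∀ a b : Fin 0,
      α (Fin.elim0 a) < α (Fin.elim0 b) ↔ (1 : Equiv.Perm (Fin 0)) a <
        (1 : Equiv.Perm (Fin 0)) b) = Finset.univ :=
    Finset.filter_true_of_mem fun α _ a => a.elim0
  rw [e] at h2
  rw [h2] at h
  rw [h]
  exact (Finset.sum_congr h3 fun _ _ => rfl).symm

/-- A local limit is approximated by the densities of consecutive patterns in one permutation. -/
lemma exists_perm (Λ : PermutationLocalLimit) (F : Finset FinPerm) {ε : ℝ} (hε : 0 < ε) :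
    ∃ (N : ℕ) (s : ℕ → ℕ), 0 < N ∧ Function.Injective s ∧
      (∀ i, ∀ x < N, ∀ y < N, s (i * N + x) < s (i * N + y) ↔ s x < s y) ∧
      ∀ π ∈ F, (π.length : ℝ) / N < ε ∧ |wordDensity s N π.length π - Λ.density π| < ε := by
  have hev : ∀ᶠ L : ℕ in atTop, ∀ π ∈ F, π.length ≤ L ∧ (π.length : ℝ) / L < ε / 2 := by
    rw [Finset.eventually_all]
    intro π _
    have h1 : Tendsto (fun L : ℕ => (π.length : ℝ) / L) atTop (𝓝 0) :=
      tendsto_const_nhds.div_atTop tendsto_natCast_atTop_atTop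
    exact (eventually_ge_atTop _).and (h1.eventually (gt_mem_nhds (by linarith)))
  obtain ⟨L, hL, hL0⟩ := (hev.and (eventually_gt_atTop 0)).exists
  have : NeZero L := ⟨hL0.ne'⟩
  obtain ⟨Q, α, hQ, hα⟩ := exists_sequence_average (A := Equiv.Perm (Fin L))
    (p := fun α => Λ.density ⟨L, α⟩) (fun α => measureReal_nonneg)
    (sum_density_eq_one Λ L) F
    (fun π α => wordDensity (concatWord fun _ => α) L π.length π) (half_pos hε)
  have hN : 0 < Q * L := Nat.mul_pos hQ hL0
  have : NeZero (Q * L) := ⟨hN.ne'⟩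
  have hLN : L ≤ Q * L := Nat.le_mul_of_pos_left L hQ
  -- The first `Q * L` entries are standardized to a permutation so that they can be repeated
  -- periodically.
  obtain ⟨τ, hτ⟩ := exists_perm_of_injective (n := Q * L) (h := fun i => concatWord α i)
    ((concatWord_injective α).comp Fin.val_injective)
  have hτ' : ∀ i, ∀ x, (hx : x < Q * L) → ∀ y, (hy : y < Q * L) →
      (concatWord (fun _ => τ) (i * (Q * L) + x) < concatWord (fun _ => τ) (i * (Q * L) + y) ↔
        concatWord α x < concatWord α y) := by
    intro i x hx y hy
    rw [← hτ ⟨x, hx⟩ ⟨y, hy⟩]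
    exact concatWord_lt_iff (fun _ => τ) i ⟨x, hx⟩ ⟨y, hy⟩
  have hτ0 : ∀ x, (hx : x < Q * L) → ∀ y, (hy : y < Q * L) →
      (concatWord (fun _ => τ) x < concatWord (fun _ => τ) y ↔
        concatWord α x < concatWord α y) := by
    intro x hx y hy
    have := hτ' 0 x hx y hy
    rwa [zero_mul, zero_add, zero_add] at this
  refine ⟨Q * L, concatWord fun _ => τ, hN, concatWord_injective _, ?_, ?_⟩
  · intro i x hx y hy
    rw [hτ' i x hx y hy, hτ0 x hx y hy]
  intro π hπ
  obtain ⟨hπL, hπε⟩ := hL π hπ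
  have hLr : (0 : ℝ) < L := by exact_mod_cast hL0
  refine ⟨?_, ?_⟩
  · have : (π.length : ℝ) / (Q * L : ℕ) ≤ (π.length : ℝ) / L := by
      gcongr
    linarith
  rw [wordDensity_congr hτ0]
  rcases Nat.eq_zero_or_pos π.length with h0 | h0
  · rw [wordDensity_of_length_eq_zero _ _ _ h0, density_of_length_eq_zero Λ h0]
    simpa using hε
  have A := abs_wordDensity_sub_average_le (v := concatWord α)
    (u := fun i => concatWord fun _ => α i) hL0 (le_refl (Q * L)) (fun i _ x hx y hy => by
      have a := concatWord_lt_iff α i ⟨x, hx⟩ ⟨y, hy⟩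
      have b := concatWord_lt_iff (fun _ => α i) 0 ⟨x, hx⟩ ⟨y, hy⟩
      simp only [zero_mul, zero_add] at a b
      rw [a, b]) π h0 le_rfl
  have B := hα π hπ
  rw [sum_density_mul_wordDensity Λ π h0 hπL] at B
  -- The only loss comes from intervals crossing the boundary between two windows.
  have e : (1 : ℝ) - Q * ((L : ℝ) - π.length) / (Q * L : ℕ) = (π.length : ℝ) / L := by
    have : (Q : ℝ) ≠ 0 := by positivity
    push_cast
    field_simp
    ring
  rw [e] at A
  have := abs_sub_le (wordDensity (concatWord α) (Q * L) π.length π)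
    ((∑ i ∈ Finset.range Q, wordDensity (concatWord fun _ => α i) L π.length π) / Q)
    (Λ.density π)
  linarith

theorem attainable (Λ : PermutationLocalLimit) (F : Finset FinPerm) :
    Attainable ((fun π => (fun _ => π.length, π, Λ.density π)) '' (F : Set FinPerm)) := by
  refine ⟨?_, fun ε hε => ?_⟩
  · rintro c ⟨π, -, rfl⟩
    exact Eventually.of_forall fun _ => le_refl π.length
  obtain ⟨N, s, hN, hs, hper, hF⟩ := Λ.exists_perm F (ε := ε / 3) (by linarith)
  refine ⟨fun _ => s, fun _ => hs, fun ℓ hℓ _ => ?_⟩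
  rintro c ⟨π, hπ, rfl⟩
  obtain ⟨h1, h2⟩ := hF π hπ
  have h3 : Tendsto (fun n => (N : ℝ) / ℓ n) atTop (𝓝 0) :=
    tendsto_const_nhds.div_atTop (tendsto_natCast_atTop_atTop.comp hℓ)
  filter_upwards [h3.eventually (gt_mem_nhds (show (0 : ℝ) < ε / 3 by linarith)),
    hℓ.eventually_ge_atTop N] with n h4 h5
  have A := abs_wordDensity_sub_le_add hN h5 hper π (le_refl π.length)
  have := abs_sub_le (wordDensity s (ℓ n) π.length π) (wordDensity s N π.length π) (Λ.density π)
  linarith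

end PermutationLocalLimit

/-! ### Approximating a permuton by random samples -/

/-- Bernoulli's inequality for `(1 - m / M) ^ m`. The right side is the proportion of injective
`m`-tuples among all `m`-tuples from `M` elements. -/
lemma one_sub_sq_div_le_descFactorial_div_pow {M m : ℕ} (hm : m ≤ M) (hM : 0 < M) :
    1 - (m : ℝ) ^ 2 / M ≤ (M.descFactorial m : ℝ) / (M : ℝ) ^ m := by
  have hMr : (0 : ℝ) < M := by exact_mod_cast hM
  have h1 : ((M : ℝ) - m) ^ m ≤ M.descFactorial m := by
    rw [← Nat.cast_sub hm]
    refine le_trans ?_ (Nat.cast_le.2 (Nat.pow_sub_le_descFactorial M m))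
    push_cast
    gcongr
    omega
  have h2 := one_add_mul_le_pow (a := -((m : ℝ) / M)) (by
    have : (m : ℝ) / M ≤ 1 := div_le_one_of_le₀ (by exact_mod_cast hm) hMr.le
    linarith) m
  calc 1 - (m : ℝ) ^ 2 / M = 1 + m * -((m : ℝ) / M) := by ring
    _ ≤ (1 + -((m : ℝ) / M)) ^ m := h2
    _ = ((M : ℝ) - m) ^ m / (M : ℝ) ^ m := by
        rw [← div_pow]
        congr 1
        field_simp
        ring
    _ ≤ _ := by gcongr

lemma card_filter_injective (ι : Type*) [Fintype ι] [DecidableEq ι] (M : ℕ)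
    [DecidablePred fun i : ι → Fin M => Function.Injective i] :
    (Finset.univ.filter fun i : ι → Fin M => Function.Injective i).card =
      M.descFactorial (Fintype.card ι) := by
  rw [← Fintype.card_subtype,
    Fintype.card_congr (Equiv.subtypeInjectiveEquivEmbedding ι (Fin M)),
    Fintype.card_embedding_eq, Fintype.card_fin]

open Classical in
/-- The proportion of the `k`-tuples of points of the sample `ω` that lie in `A`. -/
def tupleFrequency {X : Type*} {k M : ℕ} (A : Set (Fin k → X)) (ω : Fin M → X) : ℝ :=
  ((Finset.univ.filter fun i : Fin k → Fin M => (fun a => ω (i a)) ∈ A).card : ℝ) / (M : ℝ) ^ k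

lemma tupleFrequency_eq_sum {X : Type*} {k M : ℕ} (A : Set (Fin k → X)) (ω : Fin M → X) :
    tupleFrequency A ω =
      (∑ i : Fin k → Fin M, A.indicator (1 : (Fin k → X) → ℝ) fun a => ω (i a)) /
        (M : ℝ) ^ k := by
  classical
  unfold tupleFrequency
  congr 1
  rw [Finset.card_filter]
  push_cast
  exact Finset.sum_congr rfl fun i _ => by simp [Set.indicator_apply]

section Sampling

variable {X : Type*} [MeasurableSpace X] (μ : Measure X) [IsProbabilityMeasure μ]

lemma map_comp_pi {ι κ : Type*} [Fintype ι] [Fintype κ] {i : κ → ι} (hi : Function.Injective i) :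
    (Measure.pi fun _ : ι => μ).map (fun ω a => ω (i a)) = Measure.pi fun _ : κ => μ := by
  have h := (ProbabilityTheory.iIndepFun_pi (μ := fun _ : ι => μ) (X := fun _ x => x)
    (fun _ => aemeasurable_id)).precomp hi
  rw [ProbabilityTheory.iIndepFun_iff_map_fun_eq_pi_map
    (fun a => (measurable_pi_apply _).aemeasurable)] at h
  rw [h]
  congr 1
  funext a
  exact (measurePreserving_eval (fun _ : ι => μ) (i a)).map_eq

lemma indepFun_comp_pi {ι κ κ' : Type*} [Fintype ι] [Fintype κ] [Fintype κ'] {i : κ → ι}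
    {j : κ' → ι} (hij : ∀ a b, i a ≠ j b) :
    ProbabilityTheory.IndepFun (fun (ω : ι → X) a => ω (i a)) (fun ω b => ω (j b))
      (Measure.pi fun _ : ι => μ) := by
  classical
  have h := (ProbabilityTheory.iIndepFun_pi (μ := fun _ : ι => μ) (X := fun _ x => x)
    (fun _ => aemeasurable_id)).indepFun_finset (Finset.univ.image i) (Finset.univ.image j)
    (by
      rw [Finset.disjoint_left]
      intro x hx hx'
      obtain ⟨a, -, rfl⟩ := Finset.mem_image.1 hx
      obtain ⟨b, -, hb⟩ := Finset.mem_image.1 hx'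
      exact hij a b hb.symm) (fun a => measurable_pi_apply a)
  exact h.comp (φ := fun y a => y ⟨i a, Finset.mem_image_of_mem _ (Finset.mem_univ a)⟩)
    (ψ := fun y b => y ⟨j b, Finset.mem_image_of_mem _ (Finset.mem_univ b)⟩)
    (measurable_pi_iff.2 fun a => measurable_pi_apply _)
    (measurable_pi_iff.2 fun a => measurable_pi_apply _)

lemma measurable_indicator_comp {k M : ℕ} {A : Set (Fin k → X)} (hA : MeasurableSet A)
    (i : Fin k → Fin M) :
    Measurable fun ω : Fin M → X => A.indicator (1 : (Fin k → X) → ℝ) fun a => ω (i a) :=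
  (measurable_one.indicator hA).comp (measurable_pi_iff.2 fun _ => measurable_pi_apply _)

lemma measurable_tupleFrequency {k M : ℕ} {A : Set (Fin k → X)} (hA : MeasurableSet A) :
    Measurable fun ω : Fin M → X => tupleFrequency A ω := by
  simp only [tupleFrequency_eq_sum]
  exact (Finset.measurable_sum _ fun i _ => measurable_indicator_comp hA i).div_const _

lemma abs_indicator_sub_le_one {Y : Type*} {A : Set Y} {p : ℝ} (h0 : 0 ≤ p) (h1 : p ≤ 1) (y : Y) :
    |A.indicator (1 : Y → ℝ) y - p| ≤ 1 := by
  by_cases h : y ∈ A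
  · rw [Set.indicator_of_mem h, Pi.one_apply, abs_le]; constructor <;> linarith
  · rw [Set.indicator_of_notMem h, abs_le]; constructor <;> linarith

lemma integrable_of_abs_le_one {Y : Type*} [MeasurableSpace Y] {P : Measure Y}
    [IsProbabilityMeasure P] {f : Y → ℝ} (hf : Measurable f) (h : ∀ y, |f y| ≤ 1) :
    Integrable f P :=
  Integrable.of_bound hf.aestronglyMeasurable 1 (Eventually.of_forall h)

/-- The variance of the tuple frequency of a sample of size `M` is `O(1 / M)`. -/
lemma integral_sq_tupleFrequency_sub_le {k M : ℕ} (hM : 0 < M) (hk : k + k ≤ M)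
    {A : Set (Fin k → X)} (hA : MeasurableSet A) :
    ∫ ω, (tupleFrequency A ω - (Measure.pi fun _ : Fin k => μ).real A) ^ 2
      ∂(Measure.pi fun _ : Fin M => μ) ≤ ((k + k : ℕ) : ℝ) ^ 2 / M := by
  classical
  set p := (Measure.pi fun _ : Fin k => μ).real A with hp
  have hp0 : 0 ≤ p := measureReal_nonneg
  have hp1 : p ≤ 1 := measureReal_le_one
  set P := Measure.pi fun _ : Fin M => μ with hP
  have hMr : (0 : ℝ) < M := by exact_mod_cast hM
  let g : (Fin k → Fin M) → (Fin M → X) → ℝ := fun i ω =>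
    A.indicator (1 : (Fin k → X) → ℝ) (fun a => ω (i a)) - p
  have hgm : ∀ i, Measurable (g i) := fun i => (measurable_indicator_comp hA i).sub_const p
  have hg1 : ∀ i ω, |g i ω| ≤ 1 := fun i ω => abs_indicator_sub_le_one hp0 hp1 _
  have hggm : ∀ i j, Measurable fun ω => g i ω * g j ω := fun i j => (hgm i).mul (hgm j)
  have hgg1 : ∀ i j ω, |g i ω * g j ω| ≤ 1 := fun i j ω => by
    rw [abs_mul]; exact mul_le_one₀ (hg1 i ω) (abs_nonneg _) (hg1 j ω)
  have hggi : ∀ i j, Integrable (fun ω => g i ω * g j ω) P := fun i j =>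
    integrable_of_abs_le_one (hggm i j) (hgg1 i j)
  have hg0 : ∀ i, Function.Injective i → ∫ ω, g i ω ∂P = 0 := by
    intro i hi
    have h1 : Integrable (fun ω : Fin M → X =>
        A.indicator (1 : (Fin k → X) → ℝ) fun a => ω (i a)) P :=
      integrable_of_abs_le_one (measurable_indicator_comp hA i) fun ω => by
        simpa using abs_indicator_sub_le_one (A := A) le_rfl zero_le_one (fun a => ω (i a))
    have h2 : ∫ ω : Fin M → X, A.indicator (1 : (Fin k → X) → ℝ) (fun a => ω (i a)) ∂P = p := by
      rw [← integral_map (φ := fun (ω : Fin M → X) a => ω (i a))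
        (f := A.indicator (1 : (Fin k → X) → ℝ))
        (measurable_pi_iff.2 fun a => measurable_pi_apply _).aemeasurable
        (measurable_one.indicator hA).aestronglyMeasurable, hP, map_comp_pi μ hi,
        integral_indicator_one hA]
    rw [integral_sub h1 (integrable_const p), h2]
    simp
  -- If all `k + k` indices are distinct, the two centred indicators depend on disjoint sets of
  -- sample points and are independent.
  have hgg0 : ∀ i j, Function.Injective (Sum.elim i j) → ∫ ω, g i ω * g j ω ∂P = 0 := by
    intro i j hij
    obtain ⟨hi, hj, hd⟩ := Sum.elim_injective.1 hij
    have hind : ProbabilityTheory.IndepFun (g i) (g j) P :=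
      (indepFun_comp_pi μ hd).comp ((measurable_one.indicator hA).sub_const p)
        ((measurable_one.indicator hA).sub_const p)
    rw [hind.integral_fun_mul_eq_mul_integral (hgm i).aestronglyMeasurable
      (hgm j).aestronglyMeasurable, hg0 i hi, zero_mul]
  have hexp : ∀ ω, (tupleFrequency A ω - p) ^ 2 =
      (∑ i, ∑ j, g i ω * g j ω) / (M : ℝ) ^ (k + k) := by
    intro ω
    have : tupleFrequency A ω - p = (∑ i, g i ω) / (M : ℝ) ^ k := by
      rw [tupleFrequency_eq_sum, eq_div_iff (by positivity), sub_mul, div_mul_cancel₀ _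
        (by positivity)]
      simp [g, Finset.sum_sub_distrib, mul_comm]
    rw [this, div_pow, sq, Finset.sum_mul_sum, ← pow_mul, mul_two]
  simp only [hexp]
  rw [integral_div, integral_finsetSum _ fun i _ => integrable_finsetSum _ fun j _ => hggi i j]
  simp only [integral_finsetSum Finset.univ fun j _ => hggi _ j]
  -- Only non-injective index tuples of length `k + k` contribute, each at most `1`.
  have hle : ∑ i, ∑ j, ∫ ω, g i ω * g j ω ∂P ≤
      ((M : ℝ) ^ (k + k) - M.descFactorial (k + k)) := by
    rw [← Finset.sum_product', Finset.univ_product_univ,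
      ← (Equiv.sumArrowEquivProdArrow (Fin k) (Fin k) (Fin M)).sum_comp]
    have hcard : (Finset.univ.filter fun h : Fin k ⊕ Fin k → Fin M =>
        ¬ Function.Injective h).card + M.descFactorial (k + k) = M ^ (k + k) := by
      have h1 := Finset.card_filter_add_card_filter_not
        (s := (Finset.univ : Finset (Fin k ⊕ Fin k → Fin M))) (fun h => Function.Injective h)
      rw [card_filter_injective] at h1
      simp only [Fintype.card_sum, Fintype.card_fin, Finset.card_univ, Fintype.card_fun] at h1
      omega
    have hcard' : ((M : ℝ) ^ (k + k) - M.descFactorial (k + k)) =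
        ((Finset.univ.filter fun h : Fin k ⊕ Fin k → Fin M =>
          ¬ Function.Injective h).card : ℝ) := by
      rw [sub_eq_iff_eq_add]; exact_mod_cast hcard.symm
    rw [hcard', Finset.card_filter]
    push_cast
    refine Finset.sum_le_sum fun h _ => ?_
    by_cases hh : Function.Injective h
    · rw [if_neg (not_not.2 hh)]
      refine (hgg0 _ _ ?_).le
      convert hh
      ext x; cases x <;> rfl
    · rw [if_pos hh]
      refine (integral_mono (hggi _ _) (integrable_const 1)
        fun ω => (abs_le.1 (hgg1 _ _ ω)).2).trans ?_
      simp
  refine (div_le_div_of_nonneg_right hle (by positivity)).trans ?_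
  rw [sub_div, div_self (by positivity)]
  have := one_sub_sq_div_le_descFactorial_div_pow hk hM
  linarith

end Sampling

/-- The pattern frequencies among all tuples of points with distinct coordinates are the pattern
densities of a word. -/
lemma exists_word_of_points {M : ℕ} (hM : 0 < M) {ω : Fin M → unitInterval × unitInterval}
    (hx : Function.Injective fun i => (ω i).1) (hy : Function.Injective fun i => (ω i).2) :
    ∃ s : ℕ → ℕ, Function.Injective s ∧ ∀ π : FinPerm,
      wordDensity s M M π * M.descFactorial π.length =
        tupleFrequency {p | PointsInduce π p} ω * (M : ℝ) ^ π.length := by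
  classical
  have : NeZero M := ⟨hM.ne'⟩
  obtain ⟨σ, hσ⟩ := exists_perm_of_injective hx
  obtain ⟨η, hη⟩ := exists_perm_of_injective hy
  -- `σ` ranks the points by `x` and `η` by `y`, so `γ` sends the `x`-rank of a point to its
  -- `y`-rank.
  let γ : ℕ → ℕ := concatWord fun _ => σ.symm.trans η
  have hγ : ∀ i j : Fin M, γ i < γ j ↔ (ω (σ.symm i)).2 < (ω (σ.symm j)).2 := by
    intro i j
    have := concatWord_lt_iff (fun _ => σ.symm.trans η) 0 i j
    rw [zero_mul, zero_add, zero_add] at this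
    rw [← hη]
    exact this
  refine ⟨γ, concatWord_injective _, fun π => ?_⟩
  -- Each occurrence comes from exactly `k!` ordered tuples of points. Tuples with a repeated point
  -- never induce a pattern, since the `x`-coordinates must increase strictly.
  have hcard : ((narrowTuples M π.length M).filter fun c => InducesPattern γ π c).card *
      π.length.factorial = (Finset.univ.filter fun i : Fin π.length → Fin M =>
        PointsInduce π fun a => ω (i a)).card := by
    have hfac : (Finset.univ : Finset (Equiv.Perm (Fin π.length))).card = π.length.factorial := by
      rw [Finset.card_univ, Fintype.card_perm, Fintype.card_fin]
    rw [← hfac, ← Finset.card_product]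
    have hval : ∀ x < M, ((Fin.ofNat M x : Fin M) : ℕ) = x := fun x hx => by
      simp [Nat.mod_eq_of_lt hx]
    refine Finset.card_nbij (fun p a => σ.symm (Fin.ofNat M (p.1 (p.2 a)))) ?_ ?_ ?_
    · rintro ⟨c, t⟩ hp
      obtain ⟨hc, -⟩ := Finset.mem_product.1 (Finset.mem_coe.1 hp)
      obtain ⟨hc1, hc2⟩ := Finset.mem_filter.1 hc
      obtain ⟨h1, h2, -⟩ := mem_narrowTuples.1 hc1
      dsimp only at h1 h2 hc2
      refine Finset.mem_coe.2 (Finset.mem_filter.2 ⟨Finset.mem_univ _, t.symm, ?_, ?_⟩)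
      · intro a b hab
        dsimp only
        rw [← hσ, Equiv.apply_symm_apply, Equiv.apply_symm_apply, Equiv.apply_symm_apply,
          Equiv.apply_symm_apply, Fin.lt_def, hval _ (h1 a), hval _ (h1 b)]
        exact h2 hab
      · intro a b
        dsimp only
        rw [← hγ, Equiv.apply_symm_apply, Equiv.apply_symm_apply, hval _ (h1 a), hval _ (h1 b)]
        exact hc2 a b
    · rintro ⟨c, t⟩ hp ⟨c', t'⟩ hp' h
      obtain ⟨h1, h2, -⟩ := mem_narrowTuples.1
        (Finset.mem_filter.1 (Finset.mem_product.1 (Finset.mem_coe.1 hp)).1).1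
      obtain ⟨h1', h2', -⟩ := mem_narrowTuples.1
        (Finset.mem_filter.1 (Finset.mem_product.1 (Finset.mem_coe.1 hp')).1).1
      dsimp only at h1 h2 h1' h2' h
      have key : ∀ a, c (t a) = c' (t' a) := fun a => by
        have := congrArg Fin.val (σ.symm.injective (congrFun h a))
        rwa [hval _ (h1 _), hval _ (h1' _)] at this
      have hr : Set.range c = Set.range c' := by
        rw [← t.surjective.range_comp c, ← t'.surjective.range_comp c']
        exact congrArg Set.range (funext key)
      obtain rfl := (StrictMono.range_inj h2 h2').1 hr
      exact Prod.ext rfl (Equiv.ext fun a => h2.injective (key a))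
    · intro i hi
      obtain ⟨-, q, hq1, hq2⟩ := Finset.mem_filter.1 (Finset.mem_coe.1 hi)
      refine ⟨(fun a => (σ (i (q a)) : ℕ), q.symm), ?_, ?_⟩
      · have hmono : StrictMono fun a => ((σ (i (q a)) : Fin M) : ℕ) := fun a b hab =>
          Fin.lt_def.1 ((hσ _ _).2 (hq1 hab))
        refine Finset.mem_coe.2 (Finset.mem_product.2 ⟨Finset.mem_filter.2
          ⟨mem_narrowTuples.2 ⟨fun a => Fin.is_lt _, hmono, fun a b => ?_⟩, fun a b => ?_⟩,
          Finset.mem_univ _⟩)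
        · have := (σ (i (q b))).2
          dsimp only
          omega
        · rw [← hq2 a b, hγ, Equiv.symm_apply_apply, Equiv.symm_apply_apply]
      · funext a
        dsimp only
        rw [Equiv.apply_symm_apply, Fin.ofNat_val_eq_self, Equiv.symm_apply_apply]
  unfold wordDensity tupleFrequency
  have hMr : (0 : ℝ) < M := by exact_mod_cast hM
  rw [div_mul_cancel₀ _ (by positivity), card_narrowTuples_self]
  -- If `M` is smaller than the pattern, both sides vanish.
  rcases Nat.lt_or_ge M π.length with hlt | hle
  · have h0 : narrowTuples M π.length M = ∅ := by
      rw [← Finset.card_eq_zero, card_narrowTuples_self, Nat.choose_eq_zero_of_lt hlt]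
    rw [h0] at hcard ⊢
    simp only [Finset.filter_empty, Finset.card_empty, zero_mul] at hcard ⊢
    simp only [Set.mem_ofPred_eq, ← hcard]
    simp
  · have hc : ((M.choose π.length : ℕ) : ℝ) ≠ 0 := by
      exact_mod_cast (Nat.choose_pos hle).ne'
    rw [Nat.descFactorial_eq_factorial_mul_choose]
    push_cast
    rw [mul_comm (π.length.factorial : ℝ), ← mul_assoc, div_mul_cancel₀ _ hc]
    exact_mod_cast hcard

namespace Permuton

lemma measurableSet_pointsInduce (π : FinPerm) : MeasurableSet {p | PointsInduce π p} := by
  have : {p | PointsInduce π p} = ⋃ s : Equiv.Perm (Fin π.length),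
      ((⋂ a, ⋂ b, ⋂ _ : a < b, {p | (p (s a)).1 < (p (s b)).1}) ∩
        ⋂ a, ⋂ b, {p | (p (s a)).2 < (p (s b)).2 ↔ π.2 a < π.2 b}) := by
    ext p
    simp [PointsInduce, StrictMono]
  rw [this]
  refine MeasurableSet.iUnion fun s => MeasurableSet.inter ?_ ?_
  · exact MeasurableSet.iInter fun a => MeasurableSet.iInter fun b => MeasurableSet.iInter fun _ =>
      measurableSet_lt (measurable_pi_apply _).fst (measurable_pi_apply _).fst
  · refine MeasurableSet.iInter fun a => MeasurableSet.iInter fun b => ?_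
    have hm : MeasurableSet {p : Fin π.length → unitInterval × unitInterval |
        (p (s a)).2 < (p (s b)).2} :=
      measurableSet_lt (measurable_pi_apply _).snd (measurable_pi_apply _).snd
    by_cases h : π.2 a < π.2 b
    · simpa [h] using hm
    · convert hm.compl using 1
      ext p
      simp only [Set.mem_compl_iff, Set.mem_ofPred_eq, h, iff_false]

/-- Points sampled from a measure without atoms in one coordinate have distinct values there. -/
lemma measure_pi_not_injective {X : Type*} [MeasurableSpace X] (μ : Measure X)
    [IsProbabilityMeasure μ] {f : X → unitInterval} (hf : Measurable f)
    (h : ∀ a, μ (f ⁻¹' {a}) = 0) (M : ℕ) :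
    (Measure.pi fun _ : Fin M => μ) {ω | ¬ Function.Injective fun i => f (ω i)} = 0 := by
  have hsub : {ω : Fin M → X | ¬ Function.Injective fun i => f (ω i)} ⊆
      ⋃ i, ⋃ j, ⋃ _ : i ≠ j, {ω | f (ω i) = f (ω j)} := by
    intro ω hω
    simp only [Set.mem_ofPred_eq, Function.Injective, not_forall] at hω
    obtain ⟨i, j, hij, hne⟩ := hω
    simp only [Set.mem_iUnion]
    exact ⟨i, j, hne, hij⟩
  refine measure_mono_null hsub (measure_iUnion_null fun i => measure_iUnion_null fun j =>
    measure_iUnion_null fun hij => ?_)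
  have hm : MeasurableSet {p : X × X | f p.1 = f p.2} :=
    measurableSet_eq_fun (hf.comp measurable_fst) (hf.comp measurable_snd)
  have hind := ProbabilityTheory.iIndepFun.indepFun (ProbabilityTheory.iIndepFun_pi
    (μ := fun _ : Fin M => μ) (X := fun _ x => x) (fun _ => aemeasurable_id)) hij
  rw [ProbabilityTheory.indepFun_iff_map_prod_eq_prod_map_map
    (measurable_pi_apply i).aemeasurable (measurable_pi_apply j).aemeasurable,
    (measurePreserving_eval (fun _ : Fin M => μ) i).map_eq,
    (measurePreserving_eval (fun _ : Fin M => μ) j).map_eq] at hind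
  have e : {ω : Fin M → X | f (ω i) = f (ω j)} =
      (fun ω => (ω i, ω j)) ⁻¹' {p : X × X | f p.1 = f p.2} := rfl
  rw [e, ← Measure.map_apply ((measurable_pi_apply i).prodMk (measurable_pi_apply j)) hm, hind,
    Measure.measure_prod_null hm]
  refine Eventually.of_forall fun x => ?_
  refine measure_mono_null ?_ (h (f x))
  intro y hy
  exact hy.symm

/-- A permuton is approximated by the pattern densities of arbitrarily long permutations. -/
theorem exists_word (Γ : Permuton) (F : Finset FinPerm) {ε : ℝ} (hε : 0 < ε) (M₀ : ℕ) :
    ∃ M ≥ M₀, ∃ s : ℕ → ℕ, Function.Injective s ∧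
      ∀ π ∈ F, |wordDensity s M M π - Γ.density π| < ε := by
  classical
  have := Γ.isProbabilityMeasure
  have hlim : ∀ C : ℝ, Tendsto (fun M : ℕ => C / M) atTop (𝓝 0) := fun C =>
    tendsto_const_nhds.div_atTop tendsto_natCast_atTop_atTop
  have h1 : ∀ᶠ M : ℕ in atTop, ∀ π ∈ F, π.length + π.length ≤ M ∧
      (π.length : ℝ) ^ 2 / M < ε / 2 := by
    rw [Finset.eventually_all]
    exact fun π _ => (eventually_ge_atTop _).and
      ((hlim _).eventually (gt_mem_nhds (half_pos hε)))
  have h2 : ∀ᶠ M : ℕ in atTop,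
      (∑ π ∈ F, ((π.length + π.length : ℕ) : ℝ) ^ 2) / M < (ε / 2) ^ 2 :=
    (hlim _).eventually (gt_mem_nhds (by positivity))
  obtain ⟨M, ⟨h1, h2⟩, hM0, hM⟩ := ((h1.and h2).and
    ((eventually_ge_atTop M₀).and (eventually_gt_atTop 0))).exists
  have hMr : (0 : ℝ) < M := by exact_mod_cast hM
  let P := Measure.pi fun _ : Fin M => Γ.measure
  let f : (Fin M → unitInterval × unitInterval) → ℝ := fun ω =>
    ∑ π ∈ F, (tupleFrequency {p | PointsInduce π p} ω - Γ.density π) ^ 2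
  have hint : ∀ π : FinPerm, Integrable (fun ω : Fin M → unitInterval × unitInterval =>
      (tupleFrequency {p | PointsInduce π p} ω - Γ.density π) ^ 2) P := by
    intro π
    refine integrable_of_abs_le_one (((measurable_tupleFrequency
      (measurableSet_pointsInduce π)).sub_const _).pow_const 2) fun ω => ?_
    have a1 : 0 ≤ tupleFrequency {p | PointsInduce π p} ω := by
      unfold tupleFrequency; positivity
    have a2 : tupleFrequency {p | PointsInduce π p} ω ≤ 1 := by
      unfold tupleFrequency
      refine div_le_one_of_le₀ ?_ (by positivity)
      refine (Nat.cast_le.2 (Finset.card_filter_le _ _)).trans ?_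
      simp
    have a3 : 0 ≤ Γ.density π := measureReal_nonneg
    have a4 : Γ.density π ≤ 1 := measureReal_le_one
    rw [abs_of_nonneg (sq_nonneg _)]
    nlinarith
  have hf : ∫ ω, f ω ∂P < (ε / 2) ^ 2 := by
    refine lt_of_le_of_lt ?_ h2
    rw [integral_finsetSum _ fun π _ => hint π, Finset.sum_div]
    exact Finset.sum_le_sum fun π hπ => integral_sq_tupleFrequency_sub_le Γ.measure hM (h1 π hπ).1
      (measurableSet_pointsInduce π)
  have hN : P ({ω | ¬ Function.Injective fun i => (ω i).1} ∪
      {ω | ¬ Function.Injective fun i => (ω i).2}) = 0 := by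
    refine measure_union_null ?_ ?_
    · refine measure_pi_not_injective Γ.measure measurable_fst (fun a => ?_) M
      have := Γ.fst_uniform a a le_rfl
      rw [Set.Icc_self, sub_self, ENNReal.ofReal_zero, Set.prod_univ] at this
      exact this
    · refine measure_pi_not_injective Γ.measure measurable_snd (fun a => ?_) M
      have := Γ.snd_uniform a a le_rfl
      rw [Set.Icc_self, sub_self, ENNReal.ofReal_zero, Set.univ_prod] at this
      exact this
  -- Summing the squared errors over `F` gives one sample, with distinct coordinates, that is good
  -- for all patterns at once.
  obtain ⟨ω, hωN, hω⟩ := exists_notMem_null_le_integral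
    (integrable_finsetSum F fun π _ => hint π) hN
  have hω' : f ω < (ε / 2) ^ 2 := lt_of_le_of_lt hω hf
  rw [Set.mem_union, not_or] at hωN
  obtain ⟨s, hs, hsd⟩ := exists_word_of_points hM (not_not.1 hωN.1) (not_not.1 hωN.2)
  refine ⟨M, hM0, s, hs, fun π hπ => ?_⟩
  obtain ⟨b1, b2⟩ := h1 π hπ
  have b3 : (tupleFrequency {p | PointsInduce π p} ω - Γ.density π) ^ 2 < (ε / 2) ^ 2 :=
    lt_of_le_of_lt (Finset.single_le_sum
      (f := fun π => (tupleFrequency {p | PointsInduce π p} ω - Γ.density π) ^ 2)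
      (fun _ _ => sq_nonneg _) hπ) hω'
  have b4 := abs_lt_of_sq_lt_sq b3 (by positivity)
  have b5 := hsd π
  have b6 := one_sub_sq_div_le_descFactorial_div_pow (M := M) (m := π.length) (by omega) hM
  have b7 := wordDensity_nonneg s M M π
  have b8 := wordDensity_le_one s M M π
  have b9 : (M.descFactorial π.length : ℝ) / (M : ℝ) ^ π.length ≤ 1 :=
    div_le_one_of_le₀ (by exact_mod_cast Nat.descFactorial_le_pow M π.length) (by positivity)
  have b10 : wordDensity s M M π * ((M.descFactorial π.length : ℝ) / (M : ℝ) ^ π.length) =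
      tupleFrequency {p | PointsInduce π p} ω := by
    rw [mul_div_assoc', b5, mul_div_cancel_right₀ _ (by positivity)]
  have b11 : |wordDensity s M M π - tupleFrequency {p | PointsInduce π p} ω| < ε / 2 := by
    rw [← b10, abs_of_nonneg (by nlinarith)]
    nlinarith
  have := abs_sub_le (wordDensity s M M π) (tupleFrequency {p | PointsInduce π p} ω)
    (Γ.density π)
  linarith

end Permuton

/-! ### Ordering the scales and assembling the permutations -/

lemma IsScalingFunction.isNegligible_floor {f g : ℕ → ℝ} (hf : IsScalingFunction f)
    (hg : IsScalingFunction g) (h : IsDominatedBy f g) :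
    IsNegligible (fun n => ⌊f n⌋₊) fun n => ⌊g n⌋₊ := by
  have h2 : Tendsto (fun n => 2 * (f n / g n)) atTop (𝓝 0) := by
    simpa using Tendsto.const_mul 2 h
  refine squeeze_zero' (Eventually.of_forall fun n => by positivity) ?_ h2
  filter_upwards [eventually_ge_atTop 1, hg.tendsto_atTop.eventually_ge_atTop 2] with n hn hgn
  have h3 : (⌊f n⌋₊ : ℝ) ≤ f n := Nat.floor_le (hf.pos n hn).le
  have h4 : g n < ⌊g n⌋₊ + 1 := Nat.lt_floor_add_one _
  have h5 : 0 < f n := hf.pos n hn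
  rw [mul_div_assoc', div_le_div_iff₀ (by linarith) (by linarith)]
  nlinarith

lemma IsScalingFunction.isNegligible_floor_id {f : ℕ → ℝ} (hf : IsScalingFunction f) :
    IsNegligible (fun n => ⌊f n⌋₊) id := by
  refine squeeze_zero' (Eventually.of_forall fun n => by positivity) ?_ hf.dominated_self
  filter_upwards [eventually_ge_atTop 1] with n hn
  have h3 : (⌊f n⌋₊ : ℝ) ≤ f n := Nat.floor_le (hf.pos n hn).le
  dsimp only [id]
  gcongr

lemma isNegligible_const (k : ℕ) {w : ℕ → ℕ} (hw : Tendsto w atTop atTop) :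
    IsNegligible (fun _ => k) w :=
  tendsto_const_nhds.div_atTop (tendsto_natCast_atTop_atTop.comp hw)

lemma IsDominatedBy.trans {f g h : ℕ → ℝ} (hg : IsScalingFunction g) (hfg : IsDominatedBy f g)
    (hgh : IsDominatedBy g h) : IsDominatedBy f h := by
  have := Tendsto.mul hfg hgh
  rw [mul_zero] at this
  refine this.congr' ?_
  filter_upwards [eventually_ge_atTop 1] with n hn
  exact div_mul_div_cancel₀ (hg.pos n hn).ne'

/-- Among finitely many comparable scales there is a largest one. -/
lemma exists_dominating {f : ℕ → ℕ → ℝ} (hf : ∀ t, IsScalingFunction (f t))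
    (hdom : ∀ s t, s ≠ t → IsDominatedBy (f s) (f t) ∨ IsDominatedBy (f t) (f s))
    (T : Finset ℕ) (hT : T.Nonempty) :
    ∃ t ∈ T, ∀ s ∈ T, s ≠ t → IsDominatedBy (f s) (f t) := by
  classical
  induction hT using Finset.Nonempty.cons_induction with
  | singleton a =>
    exact ⟨a, by simp, fun s hs h => absurd (Finset.mem_singleton.1 hs) h⟩
  | cons a T ha hT ih =>
    obtain ⟨t, htT, ht⟩ := ih
    have hat : a ≠ t := fun h => ha (h ▸ htT)
    rcases hdom a t hat with h | h
    · refine ⟨t, Finset.mem_cons_of_mem htT, fun s hs hst => ?_⟩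
      rcases Finset.mem_cons.1 hs with rfl | hs
      · exact h
      · exact ht s hs hst
    · refine ⟨a, Finset.mem_cons_self _ _, fun s hs hsa => ?_⟩
      rcases Finset.mem_cons.1 hs with rfl | hs
      · exact absurd rfl hsa
      · rcases eq_or_ne s t with rfl | hst
        · exact h
        · exact (ht s hs hst).trans (hf t) h

/-- The targets at the scales `f t`, `t ∈ T`, and the local targets, for the patterns in `F`. -/
def targets (f : ℕ → ℕ → ℝ) (Ξ : ℕ → FinPerm → ℝ) (Λ : PermutationLocalLimit) (T : Finset ℕ)
    (F : Finset FinPerm) : Set ScaleTarget :=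
  {c | ∃ π ∈ F, c = (fun _ => π.length, π, Λ.density π) ∨
    ∃ t ∈ T, c = (fun n => ⌊f t n⌋₊, π, Ξ t π)}

lemma finite_targets (f : ℕ → ℕ → ℝ) (Ξ : ℕ → FinPerm → ℝ) (Λ : PermutationLocalLimit)
    (T : Finset ℕ) (F : Finset FinPerm) : (targets f Ξ Λ T F).Finite := by
  refine (((F.finite_toSet.image fun π =>
    ((fun _ => π.length, π, Λ.density π) : ScaleTarget))).union
    ((F.finite_toSet.prod T.finite_toSet).image fun p =>
      ((fun n => ⌊f p.2 n⌋₊, p.1, Ξ p.2 p.1) : ScaleTarget))).subset ?_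
  rintro c ⟨π, hπ, rfl | ⟨t, ht, rfl⟩⟩
  · exact Or.inl ⟨π, hπ, rfl⟩
  · exact Or.inr ⟨(π, t), ⟨hπ, ht⟩, rfl⟩

/-- Induction on the number of scales, removing the dominating one; the base case is the local
limit, which is the innermost level. -/
lemma attainable_targets {f : ℕ → ℕ → ℝ} (hf : ∀ t, IsScalingFunction (f t))
    (hdom : ∀ s t, s ≠ t → IsDominatedBy (f s) (f t) ∨ IsDominatedBy (f t) (f s))
    {Ξ : ℕ → FinPerm → ℝ} (hΞ : ∀ t, IsScaleLimit (Ξ t)) (Λ : PermutationLocalLimit)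
    (F : Finset FinPerm) (T : Finset ℕ) : Attainable (targets f Ξ Λ T F) := by
  induction hn : T.card generalizing T with
  | zero =>
    obtain rfl := Finset.card_eq_zero.1 hn
    convert Λ.attainable F using 1
    ext c
    simp only [targets, Finset.notMem_empty, false_and, exists_const, or_false,
      Set.mem_image, Finset.mem_coe, Set.mem_ofPred_eq]
    exact exists_congr fun π => and_congr_right fun _ => eq_comm
  | succ n ih =>
    obtain ⟨t, htT, ht⟩ := exists_dominating hf hdom T (Finset.card_pos.1 (by omega))
    have hS := ih (T.erase t) (by rw [Finset.card_erase_of_mem htT]; omega)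
    have key := hS.union_scale (w := fun n => ⌊f t n⌋₊) (hf t).tendsto_floor (by
      rintro c ⟨π, -, rfl | ⟨s, hs, rfl⟩⟩
      · exact isNegligible_const _ (hf t).tendsto_floor
      · exact (hf s).isNegligible_floor (hf t)
          (ht s (Finset.mem_of_mem_erase hs) (Finset.ne_of_mem_erase hs))) (hΞ t) F
    convert key using 1
    ext c
    constructor
    · rintro ⟨π, hπ, rfl | ⟨s, hs, rfl⟩⟩
      · exact Or.inl ⟨π, hπ, Or.inl rfl⟩
      · rcases eq_or_ne s t with rfl | hst
        · exact Or.inr ⟨π, hπ, rfl⟩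
        · exact Or.inl ⟨π, hπ, Or.inr ⟨s, Finset.mem_erase.2 ⟨hst, hs⟩, rfl⟩⟩
    · rintro (⟨π, hπ, rfl | ⟨s, hs, rfl⟩⟩ | ⟨π, hπ, rfl⟩)
      · exact ⟨π, hπ, Or.inl rfl⟩
      · exact ⟨π, hπ, Or.inr ⟨s, Finset.mem_of_mem_erase hs, rfl⟩⟩
      · exact ⟨π, hπ, Or.inr ⟨t, htT, rfl⟩⟩

/-- Finitely many of the required densities can be attained by one permutation. -/
lemma exists_perm_approximating {f : ℕ → ℕ → ℝ} (hf : ∀ t, IsScalingFunction (f t))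
    (hdom : ∀ s t, s ≠ t → IsDominatedBy (f s) (f t) ∨ IsDominatedBy (f t) (f s))
    {Ξ : ℕ → FinPerm → ℝ} (hΞ : ∀ t, IsScaleLimit (Ξ t)) (Γ : Permuton)
    (Λ : PermutationLocalLimit) (F : Finset FinPerm) (T : Finset ℕ) {ε : ℝ} (hε : 0 < ε)
    (n₀ : ℕ) :
    ∃ σ : FinPerm, n₀ ≤ σ.length ∧ ∀ π ∈ F,
      (∀ t ∈ T, |FinPerm.scaleDensity (f t σ.length) π σ - Ξ t π| < ε) ∧
        |FinPerm.globalDensity π σ - Γ.density π| < ε ∧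
        |FinPerm.localDensity π σ - Λ.density π| < ε := by
  obtain ⟨n, hn, v, hv, hv1, hv2⟩ := (attainable_targets hf hdom hΞ Λ F T).exists_word
    (finite_targets f Ξ Λ T F) (by
      rintro c ⟨π, -, rfl | ⟨t, -, rfl⟩⟩
      · exact isNegligible_const _ tendsto_id
      · exact (hf t).isNegligible_floor_id)
    -- The bound `n₀ + 1` forces `n ≥ 1`, where scaling functions are known to be positive.
    F (fun ε hε M₀ => Γ.exists_word F hε M₀) hε (n₀ + 1)
  obtain ⟨σ, hσ⟩ := exists_perm_of_injective (n := n) (h := fun i => v i)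
    (hv.comp Fin.val_injective)
  refine ⟨⟨n, σ⟩, by dsimp only [FinPerm.length]; omega, fun π hπ => ⟨fun t ht => ?_, ?_, ?_⟩⟩
  · rw [scaleDensity_eq_wordDensity hσ ((hf t).pos n (by omega)).le]
    exact hv1 (fun n => ⌊f t n⌋₊, π, Ξ t π) ⟨π, hπ, Or.inr ⟨t, ht, rfl⟩⟩
  · rw [globalDensity_eq_wordDensity hσ]
    exact hv2 π hπ
  · rw [FinPerm.localDensity, scaleDensity_eq_wordDensity hσ (by positivity), Nat.floor_natCast]
    exact hv1 (fun _ => π.length, π, Λ.density π) ⟨π, hπ, Or.inl rfl⟩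

end

theorem mainTheorem1
    (f : ℕ → ℕ → ℝ)
    (hf : ∀ t, IsScalingFunction (f t))
    (hdom : ∀ s t, s ≠ t → IsDominatedBy (f s) (f t) ∨ IsDominatedBy (f t) (f s))
    (Ξ : ℕ → FinPerm → ℝ)
    (hΞ : ∀ t, IsScaleLimit (Ξ t))
    (Γ : Permuton)
    (Λ : PermutationLocalLimit) :
    ∃ τ : ℕ → FinPerm,
      (∀ t, ConvergesAtScale (f t) τ (Ξ t)) ∧
        ConvergesGlobally τ Γ ∧
        ConvergesLocally τ Λ := by
  classical
  obtain ⟨e, he⟩ := exists_surjective_nat FinPerm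
  -- There are countably many patterns and scales, so each is included from some `j` on.
  choose τ hτ hτF using fun j : ℕ => exists_perm_approximating hf hdom hΞ Γ Λ
    ((Finset.range j).image e) (Finset.range j) (ε := 1 / ((j : ℝ) + 1)) (by positivity) j
  have hlen : Tendsto (fun j => (τ j).length) atTop atTop := tendsto_atTop_mono hτ tendsto_id
  have hlim : ∀ {x : ℕ → ℝ} {y : ℝ} (j₀ : ℕ), (∀ j ≥ j₀, |x j - y| < 1 / ((j : ℝ) + 1)) →
      Tendsto x atTop (𝓝 y) := by
    intro x y j₀ h
    rw [tendsto_iff_norm_sub_tendsto_zero]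
    refine squeeze_zero' (Eventually.of_forall fun _ => norm_nonneg _) ?_
      tendsto_one_div_add_atTop_nhds_zero_nat
    filter_upwards [eventually_ge_atTop j₀] with j hj
    exact (h j hj).le
  have hmem : ∀ i : ℕ, ∀ j ≥ i + 1, e i ∈ (Finset.range j).image e := fun i j hj =>
    Finset.mem_image_of_mem e (Finset.mem_range.2 hj)
  refine ⟨τ, fun t => ⟨hlen, fun π => ?_⟩, ⟨hlen, fun π => ?_⟩, ⟨hlen, fun π => ?_⟩⟩
  · obtain ⟨i, rfl⟩ := he π
    exact hlim (max (i + 1) (t + 1)) fun j hj =>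
      (hτF j (e i) (hmem i j ((le_max_left _ _).trans hj))).1 t
        (Finset.mem_range.2 ((le_max_right _ _).trans hj))
  · obtain ⟨i, rfl⟩ := he π
    exact hlim (i + 1) fun j hj => (hτF j (e i) (hmem i j hj)).2.1
  · obtain ⟨i, rfl⟩ := he π
    exact hlim (i + 1) fun j hj => (hτF j (e i) (hmem i j hj)).2.2
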